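/- Let $X=c_0(\mathbb R)$ or $X=\ell^p(\mathbb R)$ with $1\le p<\infty$, with its usual norm, and let $\mathcal P(X)$ be the set of Borel probability measures on $X$ with the topology of weak convergence. Let $0<\alpha\le 1$. Let $0<c<c'$ with $1<c'$, let $\alpha_n\in(c,c')$ for $n\ge 1$, and let $L:X\to X$, $L((x_n)_{n\ge1})=(\alpha_n x_{n+1})_{n\ge1}$, be the associated weighted shift. Put $\beta_k^n=\alpha_k\cdots\alpha_{k+n-1}$ and $d_n=\inf_{k\ge1}\beta_k^n$, and assume $\sum_{n\ge1}d_n^{-\alpha}<\infty$. Let $m$ be a Borel probability measure on $\mathbb R$ with support $\mathbb R$ that has adapted tails: for every $\epsilon>0$ there is a sequence $(\kappa_n)_{n\ge1}\in X$ of positive numbers with $\sum_{n\ge1}m(\mathbb R\setminus[-\beta_1^n\kappa_n,\beta_1^n\kappa_n])<\epsilon$. Let $A:X\to\mathbb R$ be bounded and $\alpha$-Hölder continuous, and define, for bounded continuous $\varphi:X\to\mathbb R$, $$\mathcal L_A(\varphi)(x)=\int_{Lv=x}e^{A(v)}\varphi(v)\,dm(v):=\int_{\mathbb R}e^{A(r,\,x_1/\alpha_1,\,x_2/\alpha_2,\dots)}\,\varphi(r,\,x_1/\alpha_1,\,x_2/\alpha_2,\dots)\,dm(r).$$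 Assume that $A$ is normalized, i.e. $\mathcal L_A(1)=1$, and let $\mathcal L_A^*:\mathcal P(X)\to\mathcal P(X)$ be the dual operator, determined by $\int\varphi\,d\mathcal L_A^*(\mu)=\int\mathcal L_A(\varphi)\,d\mu$ for all bounded continuous $\varphi$. Theorem. There is $\mu\in\mathcal P(X)$ such that $(\mathcal L_A^*)^n(\nu)\to\mu$ weakly as $n\to\infty$ for every $\nu\in\mathcal P(X)$. In particular the limit does not depend on $\nu$. Moreover, $\mathcal L_A^*(\mu)=\mu$, and $\mu$ is the only element of $\mathcal P(X)$ with this property. -/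

import Mathlib

open Filter Topology MeasureTheory
open scoped ENNReal NNReal

noncomputable section

/-- The real sequences in `ℓ^p` that tend to zero.  For `1 ≤ p < ∞` this is all of `ℓ^p(ℝ)`
(see `zeroSeq_eq_top`); for `p = ∞` it is `c₀(ℝ)` with the supremum norm
(see `SeqSpace.exists_of_tendsto`). -/
def zeroSeq (p : ℝ≥0∞) [Fact (1 ≤ p)] : Submodule ℝ (lp (fun _ : ℕ => ℝ) p) where
  carrier := {x | Tendsto (fun n => x n) atTop (𝓝 0)}
  zero_mem' := by
    exact tendsto_const_nhds (x := (0 : ℝ))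
  add_mem' := by
    intro x y hx hy
    simpa using Tendsto.add hx hy
  smul_mem' := by
    intro c x hx
    simpa using Tendsto.const_mul c hx

theorem zeroSeq_eq_top (p : ℝ≥0∞) [Fact (1 ≤ p)] (hp : p ≠ ∞) : zeroSeq p = ⊤ := by
  have hp0 : 0 < p.toReal :=
    ENNReal.toReal_pos (zero_lt_one.trans_le (Fact.out : 1 ≤ p)).ne' hp
  refine eq_top_iff.2 fun x _ => ?_
  change Tendsto (fun n => x n) atTop (𝓝 0)
  have hs := ((memℓp_gen_iff hp0).1 (lp.memℓp x)).tendsto_atTop_zero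
  have h2 := hs.rpow_const (p := p.toReal⁻¹) (Or.inr (inv_nonneg.2 hp0.le))
  rw [Real.zero_rpow (inv_pos.2 hp0).ne'] at h2
  refine tendsto_zero_iff_norm_tendsto_zero.2 (h2.congr fun n => ?_)
  exact Real.rpow_rpow_inv (norm_nonneg _) hp0.ne'

/-- The Banach space `X`: `ℓ^p(ℝ)` if `1 ≤ p < ∞`, and `c₀(ℝ)` if `p = ∞`.  Sequences are indexed
from `0`, so that `x.1 n` is the coordinate that is usually written `x_{n+1}`. -/
def SeqSpace (p : ℝ≥0∞) [Fact (1 ≤ p)] : Type := zeroSeq p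

instance SeqSpace.instNormedAddCommGroup (p : ℝ≥0∞) [Fact (1 ≤ p)] :
    NormedAddCommGroup (SeqSpace p) := inferInstanceAs (NormedAddCommGroup (zeroSeq p))

instance SeqSpace.instNormedSpace (p : ℝ≥0∞) [Fact (1 ≤ p)] :
    NormedSpace ℝ (SeqSpace p) := inferInstanceAs (NormedSpace ℝ (zeroSeq p))

instance SeqSpace.instMeasurableSpace (p : ℝ≥0∞) [Fact (1 ≤ p)] :
    MeasurableSpace (SeqSpace p) := borel _

instance SeqSpace.instBorelSpace (p : ℝ≥0∞) [Fact (1 ≤ p)] : BorelSpace (SeqSpace p) := ⟨rfl⟩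

theorem SeqSpace.ext {p : ℝ≥0∞} [Fact (1 ≤ p)] {x y : SeqSpace p}
    (h : ∀ n, x.1 n = y.1 n) : x = y :=
  Subtype.ext (lp.ext (funext h))

/-- Every null sequence is an element of `SeqSpace ∞`, whose norm is the supremum norm. -/
theorem SeqSpace.exists_of_tendsto (f : ℕ → ℝ) (hf : Tendsto f atTop (𝓝 0)) :
    ∃ x : SeqSpace ∞, (∀ n, x.1 n = f n) ∧ ‖x‖ = ⨆ n, |f n| := by
  have hb : Memℓp f ∞ := memℓp_infty (by simpa using hf.norm.bddAbove_range)
  exact ⟨⟨⟨f, hb⟩, hf⟩, fun n => rfl, rfl⟩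

/-- The weights `(α_n)` of a weighted shift: they lie in `(c, c')` for some `0 < c < c'` with
`1 < c'`.  Indexed from `0`: `w.α n` is the weight usually written `α_{n+1}`. -/
structure ShiftWeights where
  α : ℕ → ℝ
  exists_bounds : ∃ c c' : ℝ, 0 < c ∧ c < c' ∧ 1 < c' ∧ ∀ n, α n ∈ Set.Ioo c c'

namespace ShiftWeights

/-- `β_k^n = α_k ⋯ α_{k+n-1}` (with `k` counted from `0`). -/
def β (w : ShiftWeights) (k n : ℕ) : ℝ := ∏ j ∈ Finset.range n, w.α (k + j)

/-- `d_n = inf_k β_k^n`. -/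
def d (w : ShiftWeights) (n : ℕ) : ℝ := ⨅ k, w.β k n

theorem α_pos (w : ShiftWeights) (n : ℕ) : 0 < w.α n := by
  obtain ⟨c, c', h0, _, _, h⟩ := w.exists_bounds
  exact h0.trans (h n).1

theorem exists_bounds_abs (w : ShiftWeights) :
    ∃ C : ℝ, 0 ≤ C ∧ ∀ n, |w.α n| ≤ C ∧ |(w.α n)⁻¹| ≤ C := by
  obtain ⟨c, c', h0, hc, _, h⟩ := w.exists_bounds
  refine ⟨max c' c⁻¹, le_max_of_le_right (inv_pos.2 h0).le, fun n => ⟨?_, ?_⟩⟩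
  · rw [abs_of_pos (w.α_pos n)]
    exact le_max_of_le_left (h n).2.le
  · rw [abs_of_pos (inv_pos.2 (w.α_pos n))]
    exact le_max_of_le_right (inv_anti₀ h0 (h n).1.le)

end ShiftWeights

theorem Memℓp.of_abs_le_mul {p : ℝ≥0∞} [Fact (1 ≤ p)] {f g : ℕ → ℝ} (C : ℝ)
    (h : ∀ n, |f n| ≤ C * |g n|) (hg : Memℓp g p) : Memℓp f p := by
  have hC : ∀ n, |f n| ≤ |C * g n| := fun n => (h n).trans <| by
    rw [abs_mul]
    exact mul_le_mul_of_nonneg_right (le_abs_self C) (abs_nonneg _)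
  have hg' : Memℓp (fun n => C * g n) p := hg.const_mul C
  rcases eq_or_ne p ∞ with rfl | hp
  · obtain ⟨M, hM⟩ := memℓp_infty_iff.1 hg'
    refine memℓp_infty ⟨M, ?_⟩
    rintro _ ⟨n, rfl⟩
    exact (hC n).trans (hM ⟨n, rfl⟩)
  · have hp0 : 0 < p.toReal :=
      ENNReal.toReal_pos (zero_lt_one.trans_le (Fact.out : 1 ≤ p)).ne' hp
    refine memℓp_gen (Summable.of_nonneg_of_le (fun n => by positivity) (fun n => ?_)
      ((memℓp_gen_iff hp0).1 hg'))
    exact Real.rpow_le_rpow (norm_nonneg _) (hC n) hp0.le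

theorem memℓp_nat_succ_iff {p : ℝ≥0∞} [Fact (1 ≤ p)] {f : ℕ → ℝ} :
    Memℓp (fun n => f (n + 1)) p ↔ Memℓp f p := by
  rcases eq_or_ne p ∞ with rfl | hp
  · rw [memℓp_infty_iff, memℓp_infty_iff]
    constructor
    · rintro ⟨M, hM⟩
      refine ⟨max M ‖f 0‖, ?_⟩
      rintro _ ⟨n, rfl⟩
      cases n with
      | zero => exact le_max_right _ _
      | succ n => exact le_max_of_le_left (hM ⟨n, rfl⟩)
    · rintro ⟨M, hM⟩
      refine ⟨M, ?_⟩
      rintro _ ⟨n, rfl⟩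
      exact hM ⟨n + 1, rfl⟩
  · have hp0 : 0 < p.toReal :=
      ENNReal.toReal_pos (zero_lt_one.trans_le (Fact.out : 1 ≤ p)).ne' hp
    rw [memℓp_gen_iff hp0, memℓp_gen_iff hp0]
    exact summable_nat_add_iff (f := fun n => ‖f n‖ ^ p.toReal) 1

variable {p : ℝ≥0∞} [Fact (1 ≤ p)]

/-- The weighted shift `L (x_1, x_2, …) = (α_1 x_2, α_2 x_3, …)`. -/
def weightedShift (p : ℝ≥0∞) [Fact (1 ≤ p)] (w : ShiftWeights) :
    SeqSpace p →ₗ[ℝ] SeqSpace p where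
  toFun x := ⟨⟨fun n => w.α n * x.1 (n + 1), by
      obtain ⟨C, _, hC⟩ := w.exists_bounds_abs
      refine Memℓp.of_abs_le_mul C (fun n => ?_) (memℓp_nat_succ_iff.2 (lp.memℓp x.1))
      rw [abs_mul]
      exact mul_le_mul_of_nonneg_right (hC n).1 (abs_nonneg _)⟩, by
      obtain ⟨C, _, hC⟩ := w.exists_bounds_abs
      have hx : Tendsto (fun n => x.1 (n + 1)) atTop (𝓝 0) :=
        (tendsto_add_atTop_iff_nat 1).2 x.2
      refine squeeze_zero_norm (a := fun n => C * |x.1 (n + 1)|) (fun n => ?_)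
        (by simpa using hx.abs.const_mul C)
      rw [Real.norm_eq_abs]
      change |w.α n * x.1 (n + 1)| ≤ _
      rw [abs_mul]
      exact mul_le_mul_of_nonneg_right (hC n).1 (abs_nonneg _)⟩
  map_add' x y := SeqSpace.ext fun n => mul_add _ (x.1 (n + 1)) (y.1 (n + 1))
  map_smul' c x := SeqSpace.ext fun n => mul_left_comm _ c (x.1 (n + 1))

/-- The sequence `(r, x_1 / α_1, x_2 / α_2, …)`. -/
def preimageSeq (w : ShiftWeights) (r : ℝ) (x : ℕ → ℝ) : ℕ → ℝ
  | 0 => r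
  | n + 1 => x n / w.α n

/-- The preimage `(r, x_1 / α_1, x_2 / α_2, …)` of `x` under the weighted shift whose first
coordinate is `r`; see `weightedShift_eq_iff`. -/
def preimagePoint (w : ShiftWeights) (r : ℝ) (x : SeqSpace p) : SeqSpace p :=
  ⟨⟨preimageSeq w r (fun n => x.1 n), by
    obtain ⟨C, _, hC⟩ := w.exists_bounds_abs
    refine memℓp_nat_succ_iff.1 (Memℓp.of_abs_le_mul C (fun n => ?_) (lp.memℓp x.1))
    change |x.1 n / w.α n| ≤ _
    rw [div_eq_inv_mul, abs_mul]
    exact mul_le_mul_of_nonneg_right (hC n).2 (abs_nonneg _)⟩, by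
    obtain ⟨C, _, hC⟩ := w.exists_bounds_abs
    have hx : Tendsto (fun n => x.1 n) atTop (𝓝 0) := x.2
    refine (tendsto_add_atTop_iff_nat 1).1 (squeeze_zero_norm (a := fun n => C * |x.1 n|)
      (fun n => ?_) (by simpa using hx.abs.const_mul C))
    rw [Real.norm_eq_abs]
    change |x.1 n / w.α n| ≤ _
    rw [div_eq_inv_mul, abs_mul]
    exact mul_le_mul_of_nonneg_right (hC n).2 (abs_nonneg _)⟩

/-- The fibre `{v | L v = x}` is parametrized by `r ↦ (r, x_1 / α_1, x_2 / α_2, …)`. -/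
theorem weightedShift_eq_iff (w : ShiftWeights) (v x : SeqSpace p) :
    weightedShift p w v = x ↔ ∃ r, v = preimagePoint w r x := by
  constructor
  · rintro rfl
    refine ⟨v.1 0, SeqSpace.ext fun n => ?_⟩
    cases n with
    | zero => rfl
    | succ n => exact (mul_div_cancel_left₀ (v.1 (n + 1)) (w.α_pos n).ne').symm
  · rintro ⟨r, rfl⟩
    exact SeqSpace.ext fun n => mul_div_cancel₀ (x.1 n) (w.α_pos n).ne'

theorem continuous_preimagePoint (w : ShiftWeights) :
    Continuous fun q : SeqSpace p × ℝ => preimagePoint w q.2 q.1 := by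
  have hpp : (0 : ℝ≥0∞) < p := zero_lt_one.trans_le (Fact.out : 1 ≤ p)
  obtain ⟨C, hC0, hC⟩ := w.exists_bounds_abs
  let F : SeqSpace p × ℝ →ₗ[ℝ] SeqSpace p :=
    { toFun := fun q => preimagePoint w q.2 q.1
      map_add' := fun q s => SeqSpace.ext fun n => by
        cases n with
        | zero => rfl
        | succ n => exact add_div (q.1.1 n) (s.1.1 n) _
      map_smul' := fun c q => SeqSpace.ext fun n => by
        cases n with
        | zero => rfl
        | succ n => exact mul_div_assoc c (q.1.1 n) _ }
  have h1 : ∀ r : ℝ, ‖preimagePoint w r (0 : SeqSpace p)‖ = |r| := by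
    intro r
    have : (preimagePoint w r (0 : SeqSpace p)).1 = lp.single (E := fun _ : ℕ => ℝ) p 0 r := by
      refine lp.ext (funext fun n => ?_)
      cases n with
      | zero => exact (lp.single_apply_self (E := fun _ : ℕ => ℝ) p 0 r).symm
      | succ n =>
        exact (zero_div _).trans
          (lp.single_apply_ne (E := fun _ : ℕ => ℝ) p 0 r (Nat.succ_ne_zero n)).symm
    change ‖(preimagePoint w r (0 : SeqSpace p)).1‖ = |r|
    rw [this, lp.norm_single hpp, Real.norm_eq_abs]
  have h2 : ∀ x : SeqSpace p, ‖preimagePoint w 0 x‖ ≤ C * ‖x‖ := by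
    intro x
    have hle : ∀ n, ‖x.1 n / w.α n‖ ≤ C * ‖x.1 n‖ := fun n => by
      rw [div_eq_inv_mul, norm_mul]
      exact mul_le_mul_of_nonneg_right (hC n).2 (norm_nonneg _)
    change ‖(preimagePoint w 0 x).1‖ ≤ C * ‖x.1‖
    rcases eq_or_ne p ∞ with rfl | hp
    · refine lp.norm_le_of_forall_le (by positivity) fun n => ?_
      cases n with
      | zero =>
        change ‖(0 : ℝ)‖ ≤ _
        rw [norm_zero]; positivity
      | succ n =>
        exact (hle n).trans (mul_le_mul_of_nonneg_left
          (lp.norm_apply_le_norm ENNReal.top_ne_zero x.1 n) hC0)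
    · have hp0 : 0 < p.toReal := ENNReal.toReal_pos hpp.ne' hp
      refine lp.norm_le_of_tsum_le hp0 (by positivity) ?_
      have hs := (memℓp_gen_iff hp0).1 (lp.memℓp (preimagePoint w 0 x).1)
      rw [hs.tsum_eq_zero_add, Real.mul_rpow hC0 (norm_nonneg _), lp.norm_rpow_eq_tsum hp0,
        ← tsum_mul_left]
      have h0 : ‖(preimagePoint w 0 x).1 0‖ ^ p.toReal = 0 := by
        change ‖(0 : ℝ)‖ ^ p.toReal = 0
        rw [norm_zero, Real.zero_rpow hp0.ne']
      rw [h0, zero_add]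
      refine Summable.tsum_le_tsum (fun n => ?_) ((summable_nat_add_iff 1).2 hs)
        (((memℓp_gen_iff hp0).1 (lp.memℓp x.1)).mul_left _)
      rw [← Real.mul_rpow hC0 (norm_nonneg _)]
      exact Real.rpow_le_rpow (norm_nonneg _) (hle n) hp0.le
  refine AddMonoidHomClass.continuous_of_bound F (1 + C) fun q => ?_
  have hq : F q = preimagePoint w q.2 0 + preimagePoint w 0 q.1 := SeqSpace.ext fun n => by
    cases n with
    | zero => exact (add_zero q.2).symm
    | succ n =>
      change q.1.1 n / w.α n = (0 : ℝ) / w.α n + q.1.1 n / w.α n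
      rw [zero_div, zero_add]
  rw [hq, add_mul, one_mul]
  refine (norm_add_le _ _).trans (add_le_add ?_ ?_)
  · rw [h1]; exact norm_snd_le q
  · exact (h2 _).trans (mul_le_mul_of_nonneg_left (norm_fst_le q) hC0)

/-- `A ∈ Lip_b(D_X^α, X)`: `A` is bounded and `α`-Hölder continuous. -/
def IsBoundedHolder (α : ℝ≥0) (A : SeqSpace p → ℝ) : Prop :=
  (∃ M : ℝ, ∀ x, |A x| ≤ M) ∧ MemHolder α A

theorem IsBoundedHolder.continuous {α : ℝ≥0} {A : SeqSpace p → ℝ} (h : IsBoundedHolder α A)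
    (hα : 0 < α) : Continuous A := by
  obtain ⟨C, hC⟩ := h.2
  exact hC.continuous hα

/-- The Ruelle operator
`𝓛_A φ (x) = ∫_{L v = x} e^{A(v)} φ(v) dm(v) = ∫ e^{A(r, x_1/α_1, …)} φ(r, x_1/α_1, …) dm(r)`. -/
def ruelle (w : ShiftWeights) (m : Measure ℝ) (A φ : SeqSpace p → ℝ) (x : SeqSpace p) : ℝ :=
  ∫ r, Real.exp (A (preimagePoint w r x)) * φ (preimagePoint w r x) ∂m

/-- `A` is normalized: `𝓛_A 1 = 1`. -/
def IsNormalized (w : ShiftWeights) (m : Measure ℝ) (A : SeqSpace p → ℝ) : Prop :=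
  ruelle w m A (fun _ => 1) = fun _ => 1

/-- The dual operator `𝓛_A^*` on measures, `𝓛_A^*(μ)(B) = ∫∫ e^{A(v)} 1_B(v) dm(r) dμ(x)` with
`v = (r, x_1/α_1, …)`.  By `eq_ruelleDual_iff` it is determined by
`∫ φ d𝓛_A^*(μ) = ∫ 𝓛_A φ dμ` for all bounded continuous `φ`. -/
def ruelleDual (w : ShiftWeights) (m : Measure ℝ) (A : SeqSpace p → ℝ)
    (μ : Measure (SeqSpace p)) : Measure (SeqSpace p) :=
  ((μ.prod m).withDensity
    (fun q => ENNReal.ofReal (Real.exp (A (preimagePoint w q.2 q.1))))).map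
    (fun q => preimagePoint w q.2 q.1)

theorem isProbabilityMeasure_ruelleDual (w : ShiftWeights) (m : Measure ℝ)
    [IsProbabilityMeasure m] {A : SeqSpace p → ℝ} (hA : Continuous A)
    (hN : IsNormalized w m A) (μ : Measure (SeqSpace p)) [IsProbabilityMeasure μ] :
    IsProbabilityMeasure (ruelleDual w m A μ) := by
  have hc := continuous_preimagePoint (p := p) w
  have hm : Measurable fun q : SeqSpace p × ℝ =>
      ENNReal.ofReal (Real.exp (A (preimagePoint w q.2 q.1))) :=
    (Real.continuous_exp.comp (hA.comp hc)).measurable.ennreal_ofReal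
  constructor
  rw [ruelleDual, Measure.map_apply hc.measurable MeasurableSet.univ, Set.preimage_univ,
    withDensity_apply _ MeasurableSet.univ, Measure.restrict_univ, lintegral_prod _ hm.aemeasurable]
  have key : ∀ x : SeqSpace p,
      ∫⁻ r, ENNReal.ofReal (Real.exp (A (preimagePoint w r x))) ∂m = 1 := by
    intro x
    have h1 : ∫ r, Real.exp (A (preimagePoint w r x)) ∂m = 1 := by
      simpa [ruelle] using congrFun hN x
    rw [← ofReal_integral_eq_lintegral_ofReal
      (Integrable.of_integral_ne_zero (by rw [h1]; exact one_ne_zero))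
      (ae_of_all _ fun r => (Real.exp_pos _).le), h1, ENNReal.ofReal_one]
  simp [key]

theorem integral_ruelleDual (w : ShiftWeights) (m : Measure ℝ) [IsProbabilityMeasure m]
    {A : SeqSpace p → ℝ} (hA : Continuous A) (hb : ∃ M : ℝ, ∀ x, |A x| ≤ M)
    (μ : Measure (SeqSpace p)) [IsFiniteMeasure μ]
    (φ : BoundedContinuousFunction (SeqSpace p) ℝ) :
    ∫ x, φ x ∂(ruelleDual w m A μ) = ∫ x, ruelle w m A φ x ∂μ := by
  have hc := continuous_preimagePoint (p := p) w
  have he : Continuous fun q : SeqSpace p × ℝ => Real.exp (A (preimagePoint w q.2 q.1)) :=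
    Real.continuous_exp.comp (hA.comp hc)
  obtain ⟨M, hM⟩ := hb
  rw [ruelleDual, integral_map hc.measurable.aemeasurable
    φ.continuous.measurable.aestronglyMeasurable,
    integral_withDensity_eq_integral_toReal_smul he.measurable.ennreal_ofReal
      (ae_of_all _ fun q => ENNReal.ofReal_lt_top)]
  simp only [ENNReal.toReal_ofReal (Real.exp_pos _).le, smul_eq_mul]
  rw [integral_prod]
  · rfl
  · refine Integrable.of_bound
      (he.mul (φ.continuous.comp hc)).measurable.aestronglyMeasurable
      (Real.exp M * ‖φ‖) (ae_of_all _ fun q => ?_)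
    rw [norm_mul, Real.norm_eq_abs, abs_of_pos (Real.exp_pos _)]
    exact mul_le_mul (Real.exp_le_exp.2 ((le_abs_self _).trans (hM _)))
      (φ.norm_coe_le_norm _) (norm_nonneg _) (Real.exp_pos _).le

theorem eq_ruelleDual_iff (w : ShiftWeights) (m : Measure ℝ) [IsProbabilityMeasure m]
    {A : SeqSpace p → ℝ} (hA : Continuous A) (hb : ∃ M : ℝ, ∀ x, |A x| ≤ M)
    (hN : IsNormalized w m A) (μ ν : Measure (SeqSpace p)) [IsProbabilityMeasure μ]
    [IsProbabilityMeasure ν] :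
    ν = ruelleDual w m A μ ↔
      ∀ φ : BoundedContinuousFunction (SeqSpace p) ℝ,
        ∫ x, φ x ∂ν = ∫ x, ruelle w m A φ x ∂μ := by
  have := isProbabilityMeasure_ruelleDual w m hA hN μ
  constructor
  · rintro rfl φ
    exact integral_ruelleDual w m hA hb μ φ
  · intro h
    exact ext_of_forall_integral_eq_of_IsFiniteMeasure fun φ =>
      (h φ).trans (integral_ruelleDual w m hA hb μ φ).symm

/-- For a normalized potential, `𝓛_A^*` as a self-map of the space `𝓟(X)` of Borel probability
measures with the weak topology. -/
def ruelleDualProb (w : ShiftWeights) (m : Measure ℝ) [IsProbabilityMeasure m]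
    (A : SeqSpace p → ℝ) (hA : Continuous A) (hN : IsNormalized w m A)
    (μ : ProbabilityMeasure (SeqSpace p)) : ProbabilityMeasure (SeqSpace p) :=
  ⟨ruelleDual w m A μ, isProbabilityMeasure_ruelleDual w m hA hN μ⟩

/-- `m` has adapted tails: for any `ε > 0` there is a sequence `κ ∈ X` of positive numbers with
`∑_{n ≥ 1} m(ℝ \ [-β_1^n κ_n, β_1^n κ_n]) < ε`. -/
def HasAdaptedTails (p : ℝ≥0∞) [Fact (1 ≤ p)] (w : ShiftWeights) (m : Measure ℝ) : Prop :=
  ∀ ε : ℝ, 0 < ε → ∃ κ : SeqSpace p, (∀ n, 0 < κ.1 n) ∧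
    ∑' n : ℕ, m (Set.Icc (-(w.β 0 (n + 1) * κ.1 n)) (w.β 0 (n + 1) * κ.1 n))ᶜ < ENNReal.ofReal ε

end

/-!
Write `P` for the dual operator, `S z = (0, z_1/α_1, z_2/α_2, …)` for the zero inverse branch of the
shift, and `u n = 𝓛_A^n φ` for a bounded Lipschitz function `φ`, so that `u n x = ∫ φ d(P^n δ_x)`.
Three facts drive the proof.

* Two preimages with the same first coordinate differ by `S (x - y)`, and `‖S^j z‖ ≤ ‖z‖ / d_j`.
  Summability of `d_j ^ (-α)` therefore makes all `u n` Hölder with a common constant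
  (`exists_forall_abs_iterate_ruelleOp_sub_le`).
* Under `P^n δ_x` each coordinate of `v - S^n x` is a rescaled new variable `r`, or zero.
  With adapted tails, `v - S^n x` lies in a compact order interval up to small probability,
  uniformly in `n` and `x` (`HasAdaptedTails.exists_order_interval`).
* Since `|A| ≤ M`, `P` dominates `e^{-M}` times the operator `Q` with zero potential, which averages
  over all branches with weights that do not depend on the point
  (`smul_iterate_ruelleDual_zero_le`).

By the second fact, from any bounded set the random preimages fall, after some number of steps, with
probability at least `1/2` into one fixed ball. After `k` further steps, the part of the measure
that evolves under `Q` gives `u n` nearly the same integral for all starting points in that ball,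
because `S^k` shrinks the ball to a point and `u n` is uniformly Hölder. Thus if `u n` is eventually within
`h` of a constant on every bounded set, the same holds with `(1 - b) h + b η` up to an arbitrarily
small error, where `b > 0` depends on `η` but not on the bounded set
(`EventuallyNearConst.improve`). The infimum of the admissible `h` is then at most `η` for every
`η > 0`, so the `u n` become constant on bounded sets, and `∫ φ d(P^n ν) - ∫ φ d(P^n ν') → 0` for
any two probability measures (`tendsto_integral_iterate_ruelleDual_sub`).

Finally `P^n δ_0` is tight, and a cluster point provided by Prokhorov's theorem is invariant, since
`P^n δ_0` and `P^n (P δ_0)` merge (`exists_ruelleDualProb_eq_self`). Comparing an arbitrary `ν` with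
this invariant measure gives convergence and uniqueness.
-/

noncomputable section

variable {p : ℝ≥0∞} [Fact (1 ≤ p)]

/-! ### Weights and iterated inverse branches -/

namespace ShiftWeights

theorem β_pos (w : ShiftWeights) (k n : ℕ) : 0 < w.β k n :=
  Finset.prod_pos fun j _ => w.α_pos (k + j)

theorem d_le_β (w : ShiftWeights) (k n : ℕ) : w.d n ≤ w.β k n :=
  ciInf_le ⟨0, by rintro _ ⟨k, rfl⟩; exact (w.β_pos k n).le⟩ k

theorem d_pos (w : ShiftWeights) (n : ℕ) : 0 < w.d n := by
  obtain ⟨c, c', h0, _, _, h⟩ := w.exists_bounds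
  refine (pow_pos h0 n).trans_le (le_ciInf fun k => ?_)
  simpa [β] using Finset.prod_le_prod (s := Finset.range n) (f := fun _ => c)
    (g := fun j => w.α (k + j)) (fun j _ => h0.le) (fun j _ => (h _).1.le)

theorem tendsto_inv_d {w : ShiftWeights} {α : ℝ} (hα : 0 < α)
    (hd : Summable fun n : ℕ => (w.d (n + 1)) ^ (-α)) :
    Tendsto (fun n => (w.d n)⁻¹) atTop (𝓝 0) := by
  rw [← tendsto_add_atTop_iff_nat 1]
  have h := hd.tendsto_atTop_zero.rpow_const (p := α⁻¹) (Or.inr (inv_nonneg.2 hα.le))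
  rw [Real.zero_rpow (inv_pos.2 hα).ne'] at h
  refine h.congr fun n => ?_
  rw [← Real.rpow_mul (w.d_pos _).le, neg_mul, mul_inv_cancel₀ hα.ne', Real.rpow_neg_one]

end ShiftWeights

namespace SeqSpace

/-- A sequence dominated by a right shift of another one has at most the corresponding norm; this
is the only computation with the norm of `X` that is needed. -/
theorem norm_le_of_abs_shift_le {x y : SeqSpace p} {C : ℝ} (hC : 0 ≤ C) (j : ℕ)
    (h0 : ∀ n < j, x.1 n = 0) (h : ∀ n, |x.1 (n + j)| ≤ C * |y.1 n|) : ‖x‖ ≤ C * ‖y‖ := by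
  have hpp : (0 : ℝ≥0∞) < p := zero_lt_one.trans_le (Fact.out : 1 ≤ p)
  change ‖x.1‖ ≤ C * ‖y.1‖
  rcases eq_or_ne p ∞ with rfl | hp
  · refine lp.norm_le_of_forall_le (by positivity) fun n => ?_
    rcases lt_or_ge n j with hn | hn
    · rw [h0 n hn, norm_zero]; positivity
    · obtain ⟨n, rfl⟩ := Nat.exists_eq_add_of_le' hn
      exact (h n).trans (mul_le_mul_of_nonneg_left
        (lp.norm_apply_le_norm ENNReal.top_ne_zero y.1 n) hC)
  · have hp0 : 0 < p.toReal := ENNReal.toReal_pos hpp.ne' hp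
    refine lp.norm_le_of_tsum_le hp0 (by positivity) ?_
    have hs := (memℓp_gen_iff hp0).1 (lp.memℓp x.1)
    rw [← hs.sum_add_tsum_nat_add j, Real.mul_rpow hC (norm_nonneg _), lp.norm_rpow_eq_tsum hp0,
      ← tsum_mul_left, Finset.sum_eq_zero, zero_add]
    · refine Summable.tsum_le_tsum (fun n => ?_) ((summable_nat_add_iff j).2 hs)
        (((memℓp_gen_iff hp0).1 (lp.memℓp y.1)).mul_left _)
      rw [← Real.mul_rpow hC (norm_nonneg _)]
      exact Real.rpow_le_rpow (norm_nonneg _) (h n) hp0.le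
    · intro n hn
      rw [h0 n (Finset.mem_range.1 hn), norm_zero, Real.zero_rpow hp0.ne']

theorem norm_le_of_abs_le {x y : SeqSpace p} {C : ℝ} (hC : 0 ≤ C)
    (h : ∀ n, |x.1 n| ≤ C * |y.1 n|) : ‖x‖ ≤ C * ‖y‖ :=
  norm_le_of_abs_shift_le hC 0 (by simp) h

theorem abs_apply_le_norm (x : SeqSpace p) (n : ℕ) : |x.1 n| ≤ ‖x‖ :=
  lp.norm_apply_le_norm (zero_lt_one.trans_le (Fact.out : 1 ≤ p)).ne' x.1 n

theorem continuous_apply (n : ℕ) : Continuous fun x : SeqSpace p => x.1 n := by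
  refine LipschitzWith.continuous (K := 1) (LipschitzWith.of_dist_le_mul fun x y => ?_)
  rw [NNReal.coe_one, one_mul, dist_eq_norm, dist_eq_norm]
  exact abs_apply_le_norm (x - y) n

end SeqSpace

theorem preimagePoint_sub (w : ShiftWeights) (r : ℝ) (x y : SeqSpace p) :
    preimagePoint w r x - preimagePoint w r y = preimagePoint w 0 (x - y) :=
  SeqSpace.ext fun n => by
    cases n with
    | zero => exact sub_self r
    | succ n => exact (sub_div (x.1 n) (y.1 n) _).symm

theorem iterate_preimagePoint_sub (w : ShiftWeights) (j : ℕ) (x y : SeqSpace p) :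
    (preimagePoint w 0)^[j] x - (preimagePoint w 0)^[j] y = (preimagePoint w 0)^[j] (x - y) := by
  induction j generalizing x y with
  | zero => rfl
  | succ j ih => rw [Function.iterate_succ_apply, Function.iterate_succ_apply,
      Function.iterate_succ_apply, ih, preimagePoint_sub]

theorem iterate_preimagePoint_zero (w : ShiftWeights) (j : ℕ) :
    (preimagePoint w 0)^[j] (0 : SeqSpace p) = 0 := by
  simpa using (iterate_preimagePoint_sub w j (0 : SeqSpace p) 0).symm

theorem iterate_preimagePoint_apply_of_lt (w : ShiftWeights) {j n : ℕ} (h : n < j)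
    (x : SeqSpace p) : ((preimagePoint w 0)^[j] x).1 n = 0 := by
  induction j generalizing n with
  | zero => omega
  | succ j ih =>
    rw [Function.iterate_succ_apply']
    cases n with
    | zero => rfl
    | succ n =>
      change ((preimagePoint w 0)^[j] x).1 n / w.α n = 0
      rw [ih (by omega), zero_div]

theorem iterate_preimagePoint_apply_add (w : ShiftWeights) (j n : ℕ) (x : SeqSpace p) :
    ((preimagePoint w 0)^[j] x).1 (n + j) = x.1 n / w.β n j := by
  induction j with
  | zero => simp [ShiftWeights.β]
  | succ j ih =>
    rw [Function.iterate_succ_apply', ShiftWeights.β, Finset.prod_range_succ, ← div_div,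
      ← ShiftWeights.β, ← ih]
    rfl

theorem norm_iterate_preimagePoint_le (w : ShiftWeights) (j : ℕ) (x : SeqSpace p) :
    ‖(preimagePoint w 0)^[j] x‖ ≤ (w.d j)⁻¹ * ‖x‖ := by
  refine SeqSpace.norm_le_of_abs_shift_le (inv_nonneg.2 (w.d_pos j).le) j
    (fun n hn => iterate_preimagePoint_apply_of_lt w hn x) fun n => ?_
  rw [iterate_preimagePoint_apply_add, abs_div, abs_of_pos (w.β_pos n j), div_eq_inv_mul]
  exact mul_le_mul_of_nonneg_right (inv_anti₀ (w.d_pos j) (w.d_le_β n j)) (abs_nonneg _)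

/-! ### Compactness of order intervals -/

namespace SeqSpace

/-- The `n`-th unit vector of `X`. -/
def unit (p : ℝ≥0∞) [Fact (1 ≤ p)] (n : ℕ) : SeqSpace p :=
  ⟨lp.single (E := fun _ : ℕ => ℝ) p n 1, by
    refine tendsto_const_nhds.congr' ((eventually_gt_atTop n).mono fun k hk => ?_)
    exact (lp.single_apply_ne (E := fun _ : ℕ => ℝ) p n 1 hk.ne').symm⟩

/-- The vector `(y_0, …, y_{N-1}, 0, 0, …)`. -/
def trunc (p : ℝ≥0∞) [Fact (1 ≤ p)] (N : ℕ) (y : ℕ → ℝ) : SeqSpace p :=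
  ∑ i ∈ Finset.range N, y i • unit p i

theorem trunc_apply (N : ℕ) (y : ℕ → ℝ) (n : ℕ) :
    (trunc p N y).1 n = if n < N then y n else 0 := by
  induction N with
  | zero => rfl
  | succ N ih =>
    rw [trunc, Finset.sum_range_succ]
    change (trunc p N y).1 n + y N * (unit p N).1 n = _
    rw [ih]
    rcases eq_or_ne n N with rfl | hn
    · have : (unit p n).1 n = 1 := lp.single_apply_self (E := fun _ : ℕ => ℝ) p n 1
      simp [this]
    · have : (unit p N).1 n = 0 := lp.single_apply_ne (E := fun _ : ℕ => ℝ) p N 1 hn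
      have h : n < N + 1 ↔ n < N := by omega
      simp [this, h]

theorem continuous_trunc (N : ℕ) : Continuous fun y : ℕ → ℝ => trunc p N y := by
  unfold trunc
  fun_prop

theorem tendsto_trunc (x : SeqSpace p) :
    Tendsto (fun N => trunc p N (fun n => x.1 n)) atTop (𝓝 x) := by
  rcases eq_or_ne p ∞ with rfl | hp
  · rw [tendsto_iff_norm_sub_tendsto_zero, Metric.tendsto_atTop]
    intro ε hε
    have hx : Tendsto (fun n => x.1 n) atTop (𝓝 0) := x.2
    obtain ⟨N, hN⟩ := Metric.tendsto_atTop.1 hx (ε / 2) (half_pos hε)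
    refine ⟨N, fun n hn => ?_⟩
    rw [dist_zero_right, norm_norm]
    refine lt_of_le_of_lt ?_ (half_lt_self hε)
    change ‖(trunc ∞ n (fun n => x.1 n) - x).1‖ ≤ _
    refine lp.norm_le_of_forall_le (half_pos hε).le fun k => ?_
    change ‖(trunc ∞ n (fun n => x.1 n)).1 k - x.1 k‖ ≤ _
    rw [trunc_apply]
    split_ifs with h
    · simpa using (half_pos hε).le
    · have := hN k (by omega)
      rw [dist_zero_right] at this
      simpa using this.le
  · have h := (lp.hasSum_single (E := fun _ : ℕ => ℝ) hp x.1).tendsto_sum_nat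
    rw [tendsto_iff_norm_sub_tendsto_zero] at h ⊢
    refine h.congr fun N => ?_
    change _ = ‖(trunc p N (fun n => x.1 n)).1 - x.1‖
    congr 2
    refine lp.ext (funext fun n => ?_)
    rw [trunc_apply, lp.coeFn_sum, Finset.sum_apply]
    simp [lp.single_apply, Pi.single_apply]

/-- The order interval `[-κ, κ]` is compact: it is the continuous image of a product of compact
intervals, since on that product the truncations converge uniformly. -/
theorem isCompact_setOf_abs_le (κ : SeqSpace p) :
    IsCompact {x : SeqSpace p | ∀ n, |x.1 n| ≤ κ.1 n} := by
  let Q : Set (ℕ → ℝ) := Set.univ.pi fun n => Set.Icc (-κ.1 n) (κ.1 n)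
  have hQ : IsCompact Q := isCompact_univ_pi fun n => isCompact_Icc
  have hle : ∀ y ∈ Q, ∀ n, |y n| ≤ κ.1 n := fun y hy n => abs_le.2 (hy n trivial)
  have hmem : ∀ y ∈ Q, ∃ x : SeqSpace p, ∀ n, x.1 n = y n := fun y hy =>
    ⟨⟨⟨y, Memℓp.of_abs_le_mul 1 (fun n => by
        rw [one_mul]; exact (hle y hy n).trans (le_abs_self _)) (lp.memℓp κ.1)⟩,
      squeeze_zero_norm (hle y hy) κ.2⟩, fun n => rfl⟩
  choose! F hF using hmem
  have hcont : ContinuousOn F Q := by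
    refine TendstoUniformlyOn.continuousOn (F := fun N y => trunc p N y) (p := atTop) ?_
      (Frequently.of_forall fun N => (continuous_trunc N).continuousOn)
    rw [Metric.tendstoUniformlyOn_iff]
    intro ε hε
    filter_upwards [Metric.tendsto_nhds.1 (tendsto_trunc κ) ε hε] with N hN y hy
    refine lt_of_le_of_lt ?_ hN
    rw [dist_eq_norm, dist_comm, dist_eq_norm, ← one_mul ‖κ - _‖]
    refine norm_le_of_abs_le zero_le_one fun n => ?_
    change |(F y).1 n - (trunc p N y).1 n| ≤ 1 * |κ.1 n - (trunc p N (fun n => κ.1 n)).1 n|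
    rw [trunc_apply, trunc_apply, hF y hy]
    split_ifs with h
    · simp
    · simpa using (hle y hy n).trans (le_abs_self _)
  convert hQ.image_of_continuousOn hcont
  ext x
  constructor
  · intro hx
    have hxQ : (fun n => x.1 n) ∈ Q := fun n _ => abs_le.1 (hx n)
    exact ⟨_, hxQ, SeqSpace.ext fun n => hF _ hxQ n⟩
  · rintro ⟨y, hy, rfl⟩ n
    rw [hF y hy]
    exact hle y hy n

end SeqSpace

/-! ### The Ruelle operator and its dual -/

theorem measurable_ofReal_exp_preimagePoint (w : ShiftWeights)
    {A : SeqSpace p → ℝ} (hA : Continuous A) :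
    Measurable fun q : SeqSpace p × ℝ => ENNReal.ofReal (Real.exp (A (preimagePoint w q.2 q.1))) :=
  (Real.continuous_exp.comp (hA.comp (continuous_preimagePoint w))).measurable.ennreal_ofReal

theorem lintegral_exp_eq_one_of_isNormalized (w : ShiftWeights) (m : Measure ℝ)
    {A : SeqSpace p → ℝ} (hN : IsNormalized w m A) (x : SeqSpace p) :
    ∫⁻ r, ENNReal.ofReal (Real.exp (A (preimagePoint w r x))) ∂m = 1 := by
  have h1 : ∫ r, Real.exp (A (preimagePoint w r x)) ∂m = 1 := by
    simpa [ruelle] using congrFun hN x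
  rw [← ofReal_integral_eq_lintegral_ofReal
    (Integrable.of_integral_ne_zero (by rw [h1]; exact one_ne_zero))
    (ae_of_all _ fun r => (Real.exp_pos _).le), h1, ENNReal.ofReal_one]

section Operator

variable (w : ShiftWeights) (m : Measure ℝ) [IsProbabilityMeasure m] {A : SeqSpace p → ℝ}

theorem isNormalized_zero : IsNormalized (p := p) w m (fun _ => 0) := by
  funext x
  simp [ruelle]

theorem lintegral_ruelleDual (hA : Continuous A) (μ : Measure (SeqSpace p)) [SFinite μ]
    {f : SeqSpace p → ℝ≥0∞} (hf : Measurable f) :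
    ∫⁻ v, f v ∂(ruelleDual w m A μ) =
      ∫⁻ x, ∫⁻ r, ENNReal.ofReal (Real.exp (A (preimagePoint w r x))) *
        f (preimagePoint w r x) ∂m ∂μ := by
  have hc := (continuous_preimagePoint (p := p) w).measurable
  have hm := measurable_ofReal_exp_preimagePoint w hA
  rw [ruelleDual, lintegral_map hf hc,
    lintegral_withDensity_eq_lintegral_mul _ hm (g := fun q => f (preimagePoint w q.2 q.1))
      (hf.comp hc)]
  exact lintegral_prod _ (hm.mul (hf.comp hc)).aemeasurable

theorem isProbabilityMeasure_iterate_ruelleDual (hA : Continuous A) (hN : IsNormalized w m A)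
    (μ : Measure (SeqSpace p)) [IsProbabilityMeasure μ] (n : ℕ) :
    IsProbabilityMeasure ((ruelleDual w m A)^[n] μ) := by
  induction n with
  | zero => assumption
  | succ n ih =>
    rw [Function.iterate_succ_apply']
    exact isProbabilityMeasure_ruelleDual w m hA hN _

theorem continuous_ruelle (hA : Continuous A) (hb : ∃ M : ℝ, ∀ x, |A x| ≤ M)
    (φ : BoundedContinuousFunction (SeqSpace p) ℝ) : Continuous (ruelle w m A φ) := by
  have hc := continuous_preimagePoint (p := p) w
  obtain ⟨M, hM⟩ := hb
  have hF : Continuous fun q : SeqSpace p × ℝ =>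
      Real.exp (A (preimagePoint w q.2 q.1)) * φ (preimagePoint w q.2 q.1) :=
    (Real.continuous_exp.comp (hA.comp hc)).mul (φ.continuous.comp hc)
  refine continuous_of_dominated (bound := fun _ => Real.exp M * ‖φ‖)
    (fun x => (hF.comp (Continuous.prodMk_right x)).aestronglyMeasurable)
    (fun x => ae_of_all _ fun r => ?_) (integrable_const _)
    (ae_of_all _ fun r => hF.comp (Continuous.prodMk_left r))
  rw [norm_mul, Real.norm_eq_abs, abs_of_pos (Real.exp_pos _)]
  exact mul_le_mul (Real.exp_le_exp.2 ((le_abs_self _).trans (hM _)))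
    (φ.norm_coe_le_norm _) (norm_nonneg _) (Real.exp_pos _).le

/-- For a normalized potential, the Ruelle operator is an average against a probability measure,
and so preserves bounds. -/
theorem abs_ruelle_le (hA : Continuous A) (hb : ∃ M : ℝ, ∀ x, |A x| ≤ M)
    (hN : IsNormalized w m A) (φ : BoundedContinuousFunction (SeqSpace p) ℝ)
    {B : ℝ} (hB : ∀ x, |φ x| ≤ B) (x : SeqSpace p) : |ruelle w m A φ x| ≤ B := by
  have := isProbabilityMeasure_ruelleDual w m hA hN (Measure.dirac x)
  have h := integral_ruelleDual w m hA hb (Measure.dirac x) φ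
  rw [integral_dirac] at h
  rw [← h]
  simpa using norm_integral_le_of_norm_le_const (f := φ) (C := B)
    (μ := ruelleDual w m A (Measure.dirac x)) (ae_of_all _ hB)

/-- The Ruelle operator of a normalized potential as a self-map of the bounded continuous
functions. -/
def ruelleOp (hA : Continuous A) (hb : ∃ M : ℝ, ∀ x, |A x| ≤ M) (hN : IsNormalized w m A)
    (φ : BoundedContinuousFunction (SeqSpace p) ℝ) : BoundedContinuousFunction (SeqSpace p) ℝ :=
  BoundedContinuousFunction.ofNormedAddCommGroup (ruelle w m A φ) (continuous_ruelle w m hA hb φ)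
    ‖φ‖ (abs_ruelle_le w m hA hb hN φ φ.norm_coe_le_norm)

theorem abs_iterate_ruelleOp_le (hA : Continuous A) (hb : ∃ M : ℝ, ∀ x, |A x| ≤ M)
    (hN : IsNormalized w m A) {φ : BoundedContinuousFunction (SeqSpace p) ℝ}
    {B : ℝ} (hB : ∀ x, |φ x| ≤ B) (n : ℕ) (x : SeqSpace p) :
    |(ruelleOp w m hA hb hN)^[n] φ x| ≤ B := by
  induction n generalizing x with
  | zero => exact hB x
  | succ n ih =>
    rw [Function.iterate_succ_apply']
    exact abs_ruelle_le w m hA hb hN _ ih x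

theorem integral_iterate_ruelleDual (hA : Continuous A) (hb : ∃ M : ℝ, ∀ x, |A x| ≤ M)
    (hN : IsNormalized w m A) (μ : Measure (SeqSpace p)) [IsProbabilityMeasure μ]
    (φ : BoundedContinuousFunction (SeqSpace p) ℝ) (n : ℕ) :
    ∫ x, φ x ∂((ruelleDual w m A)^[n] μ) = ∫ x, (ruelleOp w m hA hb hN)^[n] φ x ∂μ := by
  induction n generalizing φ with
  | zero => rfl
  | succ n ih =>
    have := isProbabilityMeasure_iterate_ruelleDual w m hA hN μ n
    rw [Function.iterate_succ_apply', Function.iterate_succ_apply,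
      integral_ruelleDual w m hA hb]
    exact ih (ruelleOp w m hA hb hN φ)

theorem iterate_ruelleOp_apply (hA : Continuous A) (hb : ∃ M : ℝ, ∀ x, |A x| ≤ M)
    (hN : IsNormalized w m A) (φ : BoundedContinuousFunction (SeqSpace p) ℝ) (n : ℕ)
    (x : SeqSpace p) :
    (ruelleOp w m hA hb hN)^[n] φ x = ∫ v, φ v ∂((ruelleDual w m A)^[n] (Measure.dirac x)) := by
  rw [integral_iterate_ruelleDual w m hA hb hN, integral_dirac]

/-! ### Hölder bounds for the iterates -/

theorem integrable_exp_preimagePoint (hA : Continuous A) (hb : ∃ M : ℝ, ∀ x, |A x| ≤ M)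
    (x : SeqSpace p) :
    Integrable (fun r => Real.exp (A (preimagePoint w r x))) m := by
  obtain ⟨M, hM⟩ := hb
  have hc := (continuous_preimagePoint (p := p) w).comp (Continuous.prodMk_right x)
  refine Integrable.of_bound (Real.continuous_exp.comp (hA.comp hc)).aestronglyMeasurable
    (Real.exp M) (ae_of_all _ fun r => ?_)
  rw [Real.norm_eq_abs, abs_of_pos (Real.exp_pos _)]
  exact Real.exp_le_exp.2 ((le_abs_self _).trans (hM _))

theorem integrable_exp_mul_preimagePoint (hA : Continuous A) (hb : ∃ M : ℝ, ∀ x, |A x| ≤ M)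
    (φ : BoundedContinuousFunction (SeqSpace p) ℝ)
    (x : SeqSpace p) :
    Integrable (fun r => Real.exp (A (preimagePoint w r x)) * φ (preimagePoint w r x)) m := by
  have hc := (continuous_preimagePoint (p := p) w).comp (Continuous.prodMk_right x)
  exact (integrable_exp_preimagePoint w m hA hb x).mul_bdd (c := ‖φ‖)
    (φ.continuous.comp hc).aestronglyMeasurable (ae_of_all _ fun r => φ.norm_coe_le_norm _)

theorem abs_ruelle_sub_le (hA : Continuous A) (hb : ∃ M : ℝ, ∀ x, |A x| ≤ M)
    (hN : IsNormalized w m A) (φ : BoundedContinuousFunction (SeqSpace p) ℝ) {B : ℝ}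
    (hB : ∀ x, |φ x| ≤ B) {a g : SeqSpace p → ℝ}
    (ha : ∀ x y, |Real.exp (A x) - Real.exp (A y)| ≤ a (x - y))
    (hg : ∀ x y, |φ x - φ y| ≤ g (x - y)) (x y : SeqSpace p) :
    |ruelle w m A φ x - ruelle w m A φ y| ≤
      a (preimagePoint w 0 (x - y)) * B + g (preimagePoint w 0 (x - y)) := by
  have hi := integrable_exp_preimagePoint w m hA hb y
  have h1 : ∫ r, Real.exp (A (preimagePoint w r y)) ∂m = 1 := by
    simpa [ruelle] using congrFun hN y
  rw [ruelle, ruelle, ← integral_sub (integrable_exp_mul_preimagePoint w m hA hb φ x)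
    (integrable_exp_mul_preimagePoint w m hA hb φ y), ← Real.norm_eq_abs]
  refine (norm_integral_le_of_norm_le (g := fun r => a (preimagePoint w 0 (x - y)) * B +
    Real.exp (A (preimagePoint w r y)) * g (preimagePoint w 0 (x - y)))
    ((integrable_const _).add (hi.mul_const _)) (ae_of_all _ fun r => ?_)).trans_eq ?_
  · set v := preimagePoint w r x with hv
    set u := preimagePoint w r y with hu
    have hvu : v - u = preimagePoint w 0 (x - y) := preimagePoint_sub w r x y
    rw [← hvu, Real.norm_eq_abs,
      show Real.exp (A v) * φ v - Real.exp (A u) * φ u =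
        (Real.exp (A v) - Real.exp (A u)) * φ v + Real.exp (A u) * (φ v - φ u) by ring]
    refine (abs_add_le _ _).trans (add_le_add ?_ ?_)
    · rw [abs_mul]
      exact mul_le_mul (ha v u) (hB v) (abs_nonneg _) ((abs_nonneg _).trans (ha v u))
    · rw [abs_mul, abs_of_pos (Real.exp_pos _)]
      exact mul_le_mul_of_nonneg_left (hg v u) (Real.exp_pos _).le
  · rw [integral_add (integrable_const _) (hi.mul_const _), integral_mul_const,
      integral_mul_const, h1]
    simp

theorem abs_iterate_ruelleOp_sub_le (hA : Continuous A) (hb : ∃ M : ℝ, ∀ x, |A x| ≤ M)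
    (hN : IsNormalized w m A) {φ : BoundedContinuousFunction (SeqSpace p) ℝ} {B H G α : ℝ}
    (hB : ∀ x, |φ x| ≤ B)
    (hH : ∀ x y, |Real.exp (A x) - Real.exp (A y)| ≤ H * ‖x - y‖ ^ α)
    (hG : ∀ x y, |φ x - φ y| ≤ G * ‖x - y‖ ^ α) (n : ℕ) (x y : SeqSpace p) :
    |(ruelleOp w m hA hb hN)^[n] φ x - (ruelleOp w m hA hb hN)^[n] φ y| ≤
      H * B * ∑ j ∈ Finset.range n, ‖(preimagePoint w 0)^[j + 1] (x - y)‖ ^ α +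
        G * ‖(preimagePoint w 0)^[n] (x - y)‖ ^ α := by
  induction n generalizing x y with
  | zero => simpa using hG x y
  | succ n ih =>
    rw [Function.iterate_succ_apply']
    refine (abs_ruelle_sub_le w m hA hb hN ((ruelleOp w m hA hb hN)^[n] φ)
      (abs_iterate_ruelleOp_le w m hA hb hN hB n) (a := fun z => H * ‖z‖ ^ α)
      (g := fun z => H * B * ∑ j ∈ Finset.range n, ‖(preimagePoint w 0)^[j + 1] z‖ ^ α +
        G * ‖(preimagePoint w 0)^[n] z‖ ^ α) hH ih x y).trans_eq ?_
    rw [Finset.sum_range_succ' _ n]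
    simp only [← Function.iterate_succ_apply, Function.iterate_one, zero_add, Nat.succ_eq_add_one]
    ring

/-- The iterates of a Hölder function under the Ruelle operator are Hölder with one and the same
constant: the distortion along `n` inverse branches is controlled by `∑ d_j ^ (-α)`. -/
theorem exists_forall_abs_iterate_ruelleOp_sub_le (hA : Continuous A) (hb : ∃ M : ℝ, ∀ x, |A x| ≤ M)
    (hN : IsNormalized w m A) {φ : BoundedContinuousFunction (SeqSpace p) ℝ}
    {B H G α : ℝ} (hα : 0 < α) (hH0 : 0 ≤ H) (hG0 : 0 ≤ G)
    (hd : Summable fun n : ℕ => (w.d (n + 1)) ^ (-α)) (hB : ∀ x, |φ x| ≤ B)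
    (hH : ∀ x y, |Real.exp (A x) - Real.exp (A y)| ≤ H * ‖x - y‖ ^ α)
    (hG : ∀ x y, |φ x - φ y| ≤ G * ‖x - y‖ ^ α) :
    ∃ K : ℝ, 0 ≤ K ∧ ∀ n x y,
      |(ruelleOp w m hA hb hN)^[n] φ x - (ruelleOp w m hA hb hN)^[n] φ y| ≤ K * ‖x - y‖ ^ α := by
  have hB0 : 0 ≤ B := (abs_nonneg _).trans (hB 0)
  have hS : ∀ n (z : SeqSpace p),
      ‖(preimagePoint w 0)^[n] z‖ ^ α ≤ (w.d n) ^ (-α) * ‖z‖ ^ α := fun n z => by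
    rw [Real.rpow_neg (w.d_pos n).le, ← Real.inv_rpow (w.d_pos n).le,
      ← Real.mul_rpow (inv_nonneg.2 (w.d_pos n).le) (norm_nonneg z)]
    exact Real.rpow_le_rpow (norm_nonneg _) (norm_iterate_preimagePoint_le w n z) hα.le
  have hpos : ∀ n, 0 ≤ (w.d n) ^ (-α) := fun n => Real.rpow_nonneg (w.d_pos n).le _
  have hd' : Summable fun n => (w.d n) ^ (-α) := (summable_nat_add_iff 1).1 hd
  obtain ⟨D, hD⟩ := hd'.tendsto_atTop_zero.bddAbove_range
  have hD' : ∀ n, (w.d n) ^ (-α) ≤ D := fun n => hD ⟨n, rfl⟩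
  refine ⟨H * B * ∑' n, (w.d (n + 1)) ^ (-α) + G * D,
    add_nonneg (mul_nonneg (mul_nonneg hH0 hB0) (tsum_nonneg fun n => hpos _))
      (mul_nonneg hG0 ((hpos 0).trans (hD' 0))), fun n x y => ?_⟩
  refine (abs_iterate_ruelleOp_sub_le w m hA hb hN hB hH hG n x y).trans ?_
  rw [add_mul, mul_assoc (H * B), mul_assoc G]
  refine add_le_add (mul_le_mul_of_nonneg_left ?_ (mul_nonneg hH0 hB0))
    (mul_le_mul_of_nonneg_left ((hS n _).trans
      (mul_le_mul_of_nonneg_right (hD' n) (Real.rpow_nonneg (norm_nonneg _) _))) hG0)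
  refine (Finset.sum_le_sum fun j _ => hS (j + 1) (x - y)).trans ?_
  rw [← Finset.sum_mul]
  exact mul_le_mul_of_nonneg_right (hd.sum_le_tsum _ fun j _ => hpos _)
    (Real.rpow_nonneg (norm_nonneg _) _)

theorem IsBoundedHolder.exists_abs_exp_sub_exp_le {α : ℝ≥0} (h : IsBoundedHolder α A) :
    ∃ H : ℝ, 0 ≤ H ∧
      ∀ x y, |Real.exp (A x) - Real.exp (A y)| ≤ H * ‖x - y‖ ^ (α : ℝ) := by
  obtain ⟨⟨M, hM⟩, C, hC⟩ := h
  refine ⟨Real.exp M * C, by positivity, ?_⟩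
  have key : ∀ x y, Real.exp (A x) - Real.exp (A y) ≤ Real.exp M * C * ‖x - y‖ ^ (α : ℝ) := by
    intro x y
    have h1 : |A x - A y| ≤ C * ‖x - y‖ ^ (α : ℝ) := by
      simpa [Real.dist_eq, dist_eq_norm] using hC.dist_le x y
    have h2 := Real.add_one_le_exp (A y - A x)
    have h3 : Real.exp (A y) = Real.exp (A x) * Real.exp (A y - A x) := by
      rw [← Real.exp_add]; ring_nf
    have h4 : Real.exp (A x) ≤ Real.exp M := Real.exp_le_exp.2 ((le_abs_self _).trans (hM x))
    calc Real.exp (A x) - Real.exp (A y) = Real.exp (A x) * (1 - Real.exp (A y - A x)) := by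
          rw [h3]; ring
      _ ≤ Real.exp (A x) * |A x - A y| :=
          mul_le_mul_of_nonneg_left (by linarith [le_abs_self (A x - A y)]) (Real.exp_pos _).le
      _ ≤ Real.exp M * (C * ‖x - y‖ ^ (α : ℝ)) :=
          mul_le_mul h4 h1 (abs_nonneg _) (Real.exp_pos _).le
      _ = _ := (mul_assoc _ _ _).symm
  intro x y
  refine abs_le.2 ⟨?_, key x y⟩
  have := key y x
  rw [norm_sub_rev] at this
  linarith

end Operator

/-! ### Uniform tail estimates -/

/-- Each coordinate of a random `n`-th preimage of `x` is, relative to the `n`-th preimage of `x`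
along the zero branch, a rescaled fresh variable or zero; hence the tail bound below, uniform in
`n` and `x`. -/
theorem iterate_ruelleDual_dirac_abs_gt_le (w : ShiftWeights) (m : Measure ℝ)
    [IsProbabilityMeasure m] {A : SeqSpace p → ℝ} (hA : Continuous A) {M : ℝ}
    (hM : ∀ x, |A x| ≤ M) (hN : IsNormalized w m A) (n j : ℕ) {t : ℝ} (ht : 0 ≤ t)
    (x : SeqSpace p) :
    (ruelleDual w m A)^[n] (Measure.dirac x) {v | t < |v.1 j - ((preimagePoint w 0)^[n] x).1 j|} ≤
      ENNReal.ofReal (Real.exp M) * m {r | w.β 0 j * t < |r|} := by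
  have hopen : ∀ (k : ℕ) (y s : ℝ), MeasurableSet {v : SeqSpace p | s < |v.1 k - y|} :=
    fun k y s => (isOpen_lt continuous_const
      ((SeqSpace.continuous_apply k).sub continuous_const).abs).measurableSet
  induction n generalizing j t with
  | zero =>
    have : x ∉ {v : SeqSpace p | t < |v.1 j - x.1 j|} := by simpa using ht
    simp only [Function.iterate_zero, id]
    rw [Measure.dirac_apply' _ (hopen j (x.1 j) t), Set.indicator_of_notMem this]
    exact zero_le
  | succ n ih =>
    have := isProbabilityMeasure_iterate_ruelleDual w m hA hN (Measure.dirac x) n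
    rw [Function.iterate_succ_apply', Function.iterate_succ_apply',
      ← lintegral_indicator_one (hopen _ _ _),
      lintegral_ruelleDual w m hA _ (measurable_one.indicator (hopen _ _ _))]
    cases j with
    | zero =>
      have hset : MeasurableSet {r : ℝ | t < |r|} :=
        (isOpen_lt continuous_const continuous_abs).measurableSet
      calc _ ≤ ∫⁻ _, ∫⁻ r, ENNReal.ofReal (Real.exp M) * {r : ℝ | t < |r|}.indicator 1 r ∂m
              ∂((ruelleDual w m A)^[n] (Measure.dirac x)) := by
            refine lintegral_mono fun v => lintegral_mono fun r => mul_le_mul'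
              (ENNReal.ofReal_le_ofReal
                (Real.exp_le_exp.2 ((le_abs_self _).trans (hM _)))) (le_of_eq ?_)
            change {v : SeqSpace p | t < |v.1 0 - 0|}.indicator (1 : SeqSpace p → ℝ≥0∞)
              (preimagePoint w r v) = _
            simp only [Set.indicator_apply, Set.mem_ofPred_eq, sub_zero, Pi.one_apply]
            rfl
        _ = _ := by
            rw [lintegral_const, measure_univ, mul_one, lintegral_const_mul _
              (measurable_one.indicator hset), lintegral_indicator_one hset]
            simp [ShiftWeights.β]
    | succ j =>
      have hα := w.α_pos j
      rw [ShiftWeights.β, Finset.prod_range_succ, zero_add, ← ShiftWeights.β, mul_assoc]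
      refine le_trans (le_of_eq ?_) (ih j (mul_nonneg hα.le ht))
      rw [← lintegral_indicator_one (hopen _ _ _)]
      refine lintegral_congr fun v => ?_
      set y := ((preimagePoint w 0)^[n] x).1 j
      have h1 : ∀ r, {u : SeqSpace p | t < |u.1 (j + 1) -
            (preimagePoint w 0 ((preimagePoint w 0)^[n] x)).1 (j + 1)|}.indicator
            (1 : SeqSpace p → ℝ≥0∞) (preimagePoint w r v) =
          {u : SeqSpace p | w.α j * t < |u.1 j - y|}.indicator 1 v := fun r => by
        have : t < |v.1 j / w.α j - y / w.α j| ↔ w.α j * t < |v.1 j - y| := by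
          rw [← sub_div, abs_div, abs_of_pos hα, lt_div_iff₀ hα, mul_comm]
        simp only [Set.indicator_apply, Set.mem_ofPred_eq, Pi.one_apply, ← this]
        rfl
      simp_rw [h1]
      have hmeas : Measurable fun r => ENNReal.ofReal (Real.exp (A (preimagePoint w r v))) :=
        (measurable_ofReal_exp_preimagePoint w hA).comp measurable_prodMk_left
      rw [lintegral_mul_const _ hmeas, lintegral_exp_eq_one_of_isNormalized w m hN, one_mul]

/-- Adapted tails confine, uniformly in `n` and `x`, the random `n`-th preimages of `x` to an order
interval around the `n`-th preimage of `x` along the zero branch. -/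
theorem HasAdaptedTails.exists_order_interval {w : ShiftWeights} {m : Measure ℝ}
    [IsProbabilityMeasure m] (hm : HasAdaptedTails p w m)
    {A : SeqSpace p → ℝ} (hA : Continuous A) (hb : ∃ M : ℝ, ∀ x, |A x| ≤ M)
    (hN : IsNormalized w m A) {ε : ℝ} (hε : 0 < ε) :
    ∃ κ : SeqSpace p, (∀ j, 0 ≤ κ.1 j) ∧ ∀ n x,
      (ruelleDual w m A)^[n] (Measure.dirac x)
        {v | ∀ j, |v.1 j - ((preimagePoint w 0)^[n] x).1 j| ≤ κ.1 j}ᶜ ≤ ENNReal.ofReal ε := by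
  obtain ⟨M, hM⟩ := hb
  obtain ⟨C, hC0, hC⟩ := w.exists_bounds_abs
  obtain ⟨κ, hκ, hsum⟩ := hm (ε / Real.exp M) (by positivity)
  -- The factor `C` absorbs the weight by which `β_1^{n}` and `β_1^{n+1}` differ.
  refine ⟨C • κ, fun j => mul_nonneg hC0 (hκ j).le, fun n x => ?_⟩
  have hcompl : {v : SeqSpace p | ∀ j, |v.1 j - ((preimagePoint w 0)^[n] x).1 j| ≤
      (C • κ).1 j}ᶜ =
      ⋃ j, {v : SeqSpace p | C * κ.1 j < |v.1 j - ((preimagePoint w 0)^[n] x).1 j|} := by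
    ext v
    simp only [Set.mem_compl_iff, Set.mem_ofPred_eq, not_forall, not_le, Set.mem_iUnion]
    rfl
  rw [hcompl]
  refine (measure_iUnion_le _).trans ((ENNReal.tsum_le_tsum fun j =>
    (iterate_ruelleDual_dirac_abs_gt_le w m hA hM hN n j (mul_nonneg hC0 (hκ j).le) x).trans
      (mul_le_mul_right (measure_mono (t := (Set.Icc (-(w.β 0 (j + 1) * κ.1 j))
        (w.β 0 (j + 1) * κ.1 j))ᶜ) fun r hr => ?_) _)).trans ?_)
  · rw [Set.mem_compl_iff, Set.mem_Icc, ← abs_le, not_le]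
    refine lt_of_le_of_lt ?_ hr
    rw [ShiftWeights.β, Finset.prod_range_succ, zero_add, ← ShiftWeights.β, mul_assoc]
    exact mul_le_mul_of_nonneg_left (mul_le_mul_of_nonneg_right
      ((le_abs_self _).trans (hC j).1) (hκ j).le) (w.β_pos 0 j).le
  · rw [ENNReal.tsum_mul_left]
    refine (mul_le_mul_right hsum.le _).trans_eq ?_
    rw [← ENNReal.ofReal_mul (Real.exp_pos M).le, mul_div_cancel₀ _ (Real.exp_pos M).ne']

/-- Outside a ball the random `n`-th preimages of `x` have small mass; the radius depends on `x`
only through the `n`-th preimage along the zero branch. -/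
theorem HasAdaptedTails.exists_radius {w : ShiftWeights} {m : Measure ℝ}
    [IsProbabilityMeasure m] (hm : HasAdaptedTails p w m)
    {A : SeqSpace p → ℝ} (hA : Continuous A) (hb : ∃ M : ℝ, ∀ x, |A x| ≤ M)
    (hN : IsNormalized w m A) {ε : ℝ} (hε : 0 < ε) :
    ∃ R₀ : ℝ, ∀ n x R, R₀ + (w.d n)⁻¹ * ‖x‖ ≤ R →
      (ruelleDual w m A)^[n] (Measure.dirac x) (Metric.closedBall 0 R)ᶜ ≤ ENNReal.ofReal ε := by
  obtain ⟨κ, hκ0, hκ⟩ := hm.exists_order_interval hA hb hN hε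
  refine ⟨‖κ‖, fun n x R hR => (measure_mono (Set.compl_subset_compl.2 fun v hv => ?_)).trans
    (hκ n x)⟩
  rw [mem_closedBall_zero_iff]
  refine le_trans ?_ hR
  rw [← sub_add_cancel v ((preimagePoint w 0)^[n] x)]
  refine (norm_add_le _ _).trans (add_le_add ?_ (norm_iterate_preimagePoint_le w n x))
  rw [← one_mul ‖κ‖]
  exact SeqSpace.norm_le_of_abs_le zero_le_one fun j => by
    rw [one_mul]; exact (hv j).trans (le_abs_self _)

/-! ### Minorization -/

/-- A normalized operator with `|A| ≤ M` dominates `e^{-M}` times the operator with zero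
potential. -/
theorem smul_ruelleDual_zero_le (w : ShiftWeights) (m : Measure ℝ)
    [IsProbabilityMeasure m] {A : SeqSpace p → ℝ} (hA : Continuous A) {M : ℝ}
    (hM : ∀ x, |A x| ≤ M) {μ ν : Measure (SeqSpace p)} [SFinite μ] [SFinite ν] {c : ℝ≥0∞}
    (h : c • μ ≤ ν) :
    (ENNReal.ofReal (Real.exp (-M)) * c) • ruelleDual w m (fun _ => 0) μ ≤ ruelleDual w m A ν := by
  refine Measure.le_iff.2 fun s hs => ?_
  have hind : Measurable (s.indicator (1 : SeqSpace p → ℝ≥0∞)) := measurable_one.indicator hs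
  have hmeas : Measurable fun q : SeqSpace p × ℝ =>
      s.indicator (1 : SeqSpace p → ℝ≥0∞) (preimagePoint w q.2 q.1) :=
    hind.comp (continuous_preimagePoint w).measurable
  rw [Measure.smul_apply, ← lintegral_indicator_one hs, ← lintegral_indicator_one hs,
    lintegral_ruelleDual w m continuous_const μ hind, lintegral_ruelleDual w m hA ν hind]
  simp only [Real.exp_zero, ENNReal.ofReal_one, one_mul, smul_eq_mul]
  rw [mul_assoc, ← smul_eq_mul (a := c), ← lintegral_smul_measure]
  refine (mul_le_mul_right (lintegral_mono' h le_rfl) _).trans ?_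
  rw [← lintegral_const_mul _ hmeas.lintegral_prod_right']
  refine lintegral_mono fun x => ?_
  have hx : Measurable fun r => s.indicator (1 : SeqSpace p → ℝ≥0∞) (preimagePoint w r x) :=
    hmeas.comp measurable_prodMk_left
  rw [← lintegral_const_mul _ hx]
  exact lintegral_mono fun r => mul_le_mul_left (ENNReal.ofReal_le_ofReal
    (Real.exp_le_exp.2 (neg_le_of_abs_le (hM _)))) _

theorem smul_iterate_ruelleDual_zero_le (w : ShiftWeights) (m : Measure ℝ)
    [IsProbabilityMeasure m] {A : SeqSpace p → ℝ} (hA : Continuous A) {M : ℝ}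
    (hM : ∀ x, |A x| ≤ M) (hN : IsNormalized w m A) {μ ν : Measure (SeqSpace p)}
    [IsProbabilityMeasure μ] [IsProbabilityMeasure ν] {c : ℝ≥0∞} (h : c • μ ≤ ν) (k : ℕ) :
    (ENNReal.ofReal (Real.exp (-M)) ^ k * c) • (ruelleDual w m (fun _ => 0))^[k] μ ≤
      (ruelleDual w m A)^[k] ν := by
  induction k with
  | zero => simpa using h
  | succ k ih =>
    have := isProbabilityMeasure_iterate_ruelleDual w m hA hN ν k
    have := isProbabilityMeasure_iterate_ruelleDual (p := p) w m continuous_const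
      (isNormalized_zero w m) μ k
    rw [Function.iterate_succ_apply', Function.iterate_succ_apply', pow_succ', mul_assoc]
    exact smul_ruelleDual_zero_le w m hA hM ih

/-- If a set has measure at least `1/2`, conditioning on it at most doubles the measure. -/
theorem half_smul_cond_le {Ω : Type*} [MeasurableSpace Ω] (μ : Measure Ω) [IsProbabilityMeasure μ]
    {s : Set Ω} (hs : (2 : ℝ≥0∞)⁻¹ ≤ μ s) :
    (2 : ℝ≥0∞)⁻¹ • ProbabilityTheory.cond μ s ≤ μ := by
  have hs0 : μ s ≠ 0 := (lt_of_lt_of_le (by simp) hs).ne'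
  calc (2 : ℝ≥0∞)⁻¹ • ProbabilityTheory.cond μ s ≤ μ s • ProbabilityTheory.cond μ s := by
        refine Measure.le_iff.2 fun t _ => ?_
        rw [Measure.smul_apply, Measure.smul_apply]
        exact mul_le_mul_left hs _
    _ = μ.restrict s := by
        rw [ProbabilityTheory.cond, smul_smul, ENNReal.mul_inv_cancel hs0 (measure_ne_top μ s),
          one_smul]
    _ ≤ μ := Measure.restrict_le_self

/-- If `μ` dominates `b` times `q`, then the rest of `μ` has mass `1 - b`; the integral of `g`
against it is small when `g` is small outside a set of small `μ`-measure. -/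
theorem abs_integral_sub_mul_integral_le_of_smul_le {Ω : Type*} [MeasurableSpace Ω]
    {μ q : Measure Ω} [IsProbabilityMeasure μ] [IsProbabilityMeasure q] {b : ℝ} (hb : 0 ≤ b)
    (hle : ENNReal.ofReal b • q ≤ μ) {g : Ω → ℝ} (hg : Measurable g) {s : Set Ω}
    (hs : MeasurableSet s) {D h ε : ℝ} (hD : ∀ v, |g v| ≤ D) (hh : 0 ≤ h)
    (hgs : ∀ v ∈ s, |g v| ≤ h) (hμ : μ.real sᶜ ≤ ε) :
    |∫ v, g v ∂μ - b * ∫ v, g v ∂q| ≤ (1 - b) * h + D * ε := by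
  obtain ⟨v₀⟩ : Nonempty Ω := μ.nonempty_of_neZero
  have hD0 : 0 ≤ D := (abs_nonneg _).trans (hD v₀)
  have key : ∀ f : Ω → ℝ, Measurable f → (∀ v, |f v| ≤ D) → (∀ v ∈ s, |f v| ≤ h) →
      ∫ v, f v ∂μ - b * ∫ v, f v ∂q ≤ (1 - b) * h + D * ε := by
    intro f hf hfD hfs
    have hi : ∀ (ν : Measure Ω) [IsFiniteMeasure ν], Integrable f ν := fun ν _ =>
      Integrable.of_bound hf.aestronglyMeasurable D (ae_of_all _ hfD)
    have hi' : ∀ (ν : Measure Ω) [IsFiniteMeasure ν],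
        Integrable (fun v => h + sᶜ.indicator (fun _ => D) v) ν := fun ν _ =>
      (integrable_const _).add ((integrable_const _).indicator hs.compl)
    have hint : ∀ (ν : Measure Ω) [IsProbabilityMeasure ν],
        ∫ v, (h + sᶜ.indicator (fun _ => D) v - f v) ∂ν = h + D * ν.real sᶜ - ∫ v, f v ∂ν := by
      intro ν _
      rw [integral_sub (hi' ν) (hi ν), integral_add (integrable_const _)
        ((integrable_const _).indicator hs.compl), integral_indicator hs.compl]
      simp [mul_comm]
    -- The function `h + D 1_{sᶜ} - f` is nonnegative, so its integral is monotone in the measure.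
    have hmono := integral_mono_measure (f := fun v => h + sᶜ.indicator (fun _ => D) v - f v) hle
      (ae_of_all _ fun v => by
        have h2 : f v ≤ h + sᶜ.indicator (fun _ => D) v := by
          by_cases hv : v ∈ s
          · simpa [hv] using (le_abs_self _).trans (hfs v hv)
          · simpa [hv] using ((le_abs_self _).trans (hfD v)).trans (le_add_of_nonneg_left hh)
        exact sub_nonneg.2 h2) ((hi' μ).sub (hi μ))
    rw [integral_smul_measure, ENNReal.toReal_ofReal hb, hint, hint, smul_eq_mul] at hmono
    have h3 : 0 ≤ b * (D * q.real sᶜ) := by positivity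
    nlinarith [mul_le_mul_of_nonneg_left hμ hD0]
  refine abs_le.2 ⟨?_, key g hg hD hgs⟩
  have := key (fun v => -g v) hg.neg (by simpa using hD) (by simpa using hgs)
  rw [integral_neg, integral_neg] at this
  linarith

/-! ### Flattening of the iterates -/

/-- On each bounded set, all but finitely many of the functions `u n` are within `h` of a constant
in `[-B, B]`, which may depend on `n` and on the bounded set. -/
def EventuallyNearConst (u : ℕ → SeqSpace p → ℝ) (B h : ℝ) : Prop :=
  ∀ R : ℝ, ∃ N, ∀ n ≥ N, ∃ c, |c| ≤ B ∧ ∀ x, ‖x‖ ≤ R → |u n x - c| ≤ h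

section Flattening

variable {w : ShiftWeights} {m : Measure ℝ} [IsProbabilityMeasure m] {A : SeqSpace p → ℝ}

/-- The contraction step.  From any bounded set, the random preimages reach a fixed ball with
probability at least `1/2`; from points of that ball, the part of the next `k` steps that does not
see the potential (of mass `e^{-kM}`) brings all starting points together.  The gain `b` does not
depend on the bounded set considered. -/
theorem EventuallyNearConst.improve (hm : HasAdaptedTails p w m) (hA : Continuous A)
    (hb : ∃ M : ℝ, ∀ x, |A x| ≤ M) (hN : IsNormalized w m A)
    (hd : Tendsto (fun n => (w.d n)⁻¹) atTop (𝓝 0))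
    {φ : BoundedContinuousFunction (SeqSpace p) ℝ} {B K α : ℝ} (hα : 0 < α) (hK0 : 0 ≤ K)
    (hB : ∀ x, |φ x| ≤ B)
    (hK : ∀ n x y,
      |(ruelleOp w m hA hb hN)^[n] φ x - (ruelleOp w m hA hb hN)^[n] φ y| ≤ K * ‖x - y‖ ^ α)
    {η : ℝ} (hη : 0 < η) :
    ∃ b : ℝ, 0 < b ∧ b ≤ 1 ∧ ∀ h : ℝ, 0 ≤ h → ∀ ε : ℝ, 0 < ε →
      EventuallyNearConst (fun n => (ruelleOp w m hA hb hN)^[n] φ) B h →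
      EventuallyNearConst (fun n => (ruelleOp w m hA hb hN)^[n] φ) B
        ((1 - b) * h + b * η + ε) := by
  have hB0 : 0 ≤ B := (abs_nonneg _).trans (hB 0)
  obtain ⟨M, hM⟩ := id hb
  have hM0 : 0 ≤ M := (abs_nonneg _).trans (hM 0)
  obtain ⟨R₁, hR₁⟩ := hm.exists_radius hA hb hN (ε := 1 / 2) (by norm_num)
  set R₀ := R₁ + 1
  have hb0 : ∃ M : ℝ, ∀ x : SeqSpace p, |(fun _ => (0 : ℝ)) x| ≤ M := ⟨0, by simp⟩
  have hN0 := isNormalized_zero (p := p) w m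
  have hc0 : Continuous fun _ : SeqSpace p => (0 : ℝ) := continuous_const
  -- After `k` steps the images of the ball of radius `R₀` are so close that `u` varies by `η`.
  obtain ⟨k, hk⟩ : ∃ k, K * ((w.d k)⁻¹ * |R₀|) ^ α ≤ η := by
    have h := ((hd.mul_const |R₀|).rpow_const (p := α) (Or.inr hα.le)).const_mul K
    rw [zero_mul, Real.zero_rpow hα.ne', mul_zero] at h
    exact (h.eventually (ge_mem_nhds hη)).exists
  have hexp : Real.exp (-M) ^ k ≤ 1 :=
    pow_le_one₀ (Real.exp_pos _).le (Real.exp_le_one_iff.2 (by linarith))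
  set b := Real.exp (-M) ^ k * 2⁻¹ with hbdef
  have hb_pos : 0 < b := by positivity
  have hb_le : b ≤ 1 := by linarith
  refine ⟨b, hb_pos, hb_le, fun h hh ε hε hflat R => ?_⟩
  -- After `l` steps the ball of radius `R` enters the ball of radius `R₀` half of the time.
  obtain ⟨l, hl⟩ : ∃ l, (w.d l)⁻¹ * R ≤ 1 := by
    have h := hd.mul_const R
    rw [zero_mul] at h
    exact (h.eventually (ge_mem_nhds one_pos)).exists
  obtain ⟨R₂, hR₂⟩ := hm.exists_radius hA hb hN (ε := ε / (2 * B + 1)) (by positivity)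
  obtain ⟨N, hflatN⟩ := hflat (R₂ + (w.d (k + l))⁻¹ * R)
  refine ⟨N + (k + l), fun n hn => ?_⟩
  obtain ⟨n, rfl⟩ := Nat.exists_eq_add_of_le' ((Nat.le_add_left _ _).trans hn)
  obtain ⟨c, hcB, hc⟩ := hflatN n (by omega)
  set u := (ruelleOp w m hA hb hN)^[n] φ with hu
  have huB : ∀ x, |u x| ≤ B := abs_iterate_ruelleOp_le w m hA hb hN hB n
  set v := (ruelleOp w m hc0 hb0 hN0)^[k] u with hv
  have hvB : ∀ x, |v x| ≤ B := abs_iterate_ruelleOp_le w m hc0 hb0 hN0 huB k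
  have hvη : ∀ x, ‖x‖ ≤ R₀ → |v x - v 0| ≤ η := by
    intro x hx
    have h1 := abs_iterate_ruelleOp_sub_le w m hc0 hb0 hN0 (H := 0) huB (by simp) (hK n) k x 0
    rw [zero_mul, zero_mul, zero_add, sub_zero] at h1
    refine (h1.trans (mul_le_mul_of_nonneg_left (Real.rpow_le_rpow (norm_nonneg _)
      ((norm_iterate_preimagePoint_le w k x).trans (mul_le_mul_of_nonneg_left
        (hx.trans (le_abs_self _)) (inv_nonneg.2 (w.d_pos k).le))) hα.le) hK0)).trans hk
  refine ⟨(1 - b) * c + b * v 0, ?_, fun x hx => ?_⟩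
  · refine (abs_add_le _ _).trans ?_
    rw [abs_mul, abs_mul, abs_of_nonneg (sub_nonneg.2 hb_le), abs_of_pos hb_pos]
    nlinarith [mul_le_mul_of_nonneg_left hcB (sub_nonneg.2 hb_le),
      mul_le_mul_of_nonneg_left (hvB 0) hb_pos.le]
  have hinv : ∀ j, (w.d j)⁻¹ * ‖x‖ ≤ (w.d j)⁻¹ * R := fun j =>
    mul_le_mul_of_nonneg_left hx (inv_nonneg.2 (w.d_pos j).le)
  set τ := (ruelleDual w m A)^[l] (Measure.dirac x) with hτ
  have : IsProbabilityMeasure τ := isProbabilityMeasure_iterate_ruelleDual w m hA hN _ l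
  set μ := (ruelleDual w m A)^[k + l] (Measure.dirac x) with hμ
  have : IsProbabilityMeasure μ := isProbabilityMeasure_iterate_ruelleDual w m hA hN _ (k + l)
  have hball : (2 : ℝ≥0∞)⁻¹ ≤ τ (Metric.closedBall 0 R₀) := by
    have h1 : τ (Metric.closedBall 0 R₀)ᶜ ≤ (2 : ℝ≥0∞)⁻¹ := by
      refine (hR₁ l x R₀ (by linarith [hinv l])).trans_eq ?_
      rw [one_div, ENNReal.ofReal_inv_of_pos two_pos, ENNReal.ofReal_ofNat]
    have h2 := prob_add_prob_compl (μ := τ) (Metric.isClosed_closedBall (x := (0 : SeqSpace p))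
      (ε := R₀)).measurableSet
    rw [← ENNReal.inv_two_add_inv_two] at h2
    by_contra hlt
    exact absurd h2 (ENNReal.add_lt_add_of_lt_of_le
      (h1.trans_lt (by simp)).ne (not_le.1 hlt) h1).ne
  set lam := ProbabilityTheory.cond τ (Metric.closedBall 0 R₀) with hlam
  have : IsProbabilityMeasure lam := ProbabilityTheory.cond_isProbabilityMeasure
    (lt_of_lt_of_le (by simp) hball).ne'
  set q := (ruelleDual w m (fun _ => 0))^[k] lam with hq
  have : IsProbabilityMeasure q := isProbabilityMeasure_iterate_ruelleDual w m hc0 hN0 _ k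
  have hle : ENNReal.ofReal b • q ≤ μ := by
    have h1 := smul_iterate_ruelleDual_zero_le w m hA hM hN (half_smul_cond_le τ hball) k
    rw [hμ, Function.iterate_add_apply, hbdef, ENNReal.ofReal_mul (by positivity),
      ENNReal.ofReal_pow (Real.exp_pos _).le, ENNReal.ofReal_inv_of_pos two_pos,
      ENNReal.ofReal_ofNat]
    exact h1
  have hqv : |∫ y, u y ∂q - v 0| ≤ η := by
    have h1 : ∫ y, u y ∂q = ∫ y, v y ∂lam := integral_iterate_ruelleDual w m hc0 hb0 hN0 lam u k
    have h2 : ∫ y, u y ∂q - v 0 = ∫ y, (v y - v 0) ∂lam := by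
      rw [h1, integral_sub (v.integrable lam) (integrable_const _)]
      simp
    rw [h2]
    have h3 : ∀ᵐ y ∂lam, ‖v y - v 0‖ ≤ η :=
      (ProbabilityTheory.ae_cond_mem Metric.isClosed_closedBall.measurableSet).mono
        fun y hy => hvη y (mem_closedBall_zero_iff.1 hy)
    simpa using norm_integral_le_of_norm_le_const h3
  have hμu : (ruelleOp w m hA hb hN)^[n + (k + l)] φ x = ∫ y, u y ∂μ := by
    rw [add_comm n, Function.iterate_add_apply]
    exact iterate_ruelleOp_apply w m hA hb hN u (k + l) x
  have hS : μ.real (Metric.closedBall 0 (R₂ + (w.d (k + l))⁻¹ * R))ᶜ ≤ ε / (2 * B + 1) :=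
    ENNReal.toReal_le_of_le_ofReal (by positivity)
      (hR₂ (k + l) x _ (add_le_add_right (hinv _) _))
  have hmain := abs_integral_sub_mul_integral_le_of_smul_le hb_pos.le hle (g := fun y => u y - c)
    (u.continuous.measurable.sub measurable_const) Metric.isClosed_closedBall.measurableSet
    (D := 2 * B) (fun y => (abs_sub _ _).trans (by linarith [huB y])) hh
    (fun y hy => hc y (mem_closedBall_zero_iff.1 hy)) hS
  rw [integral_sub (u.integrable μ) (integrable_const _),
    integral_sub (u.integrable q) (integrable_const _)] at hmain
  simp only [integral_const, probReal_univ, smul_eq_mul, one_mul] at hmain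
  have hε' : 2 * B * (ε / (2 * B + 1)) ≤ ε := by
    rw [← mul_div_assoc, div_le_iff₀ (by positivity)]
    nlinarith
  beta_reduce
  rw [hμu, show ∫ y, u y ∂μ - ((1 - b) * c + b * v 0) =
    (∫ y, u y ∂μ - c - b * (∫ y, u y ∂q - c)) + b * (∫ y, u y ∂q - v 0) by ring]
  refine (abs_add_le _ _).trans ?_
  rw [abs_mul b, abs_of_pos hb_pos]
  linarith [mul_le_mul_of_nonneg_left hqv hb_pos.le]

/-- Iterating the contraction step: the functions `𝓛^n φ` become constant on bounded sets. -/
theorem eventuallyNearConst_iterate_ruelleOp (hm : HasAdaptedTails p w m) (hA : Continuous A)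
    (hb : ∃ M : ℝ, ∀ x, |A x| ≤ M) (hN : IsNormalized w m A)
    (hd : Tendsto (fun n => (w.d n)⁻¹) atTop (𝓝 0))
    {φ : BoundedContinuousFunction (SeqSpace p) ℝ} {B K α : ℝ} (hα : 0 < α) (hK0 : 0 ≤ K)
    (hB : ∀ x, |φ x| ≤ B)
    (hK : ∀ n x y,
      |(ruelleOp w m hA hb hN)^[n] φ x - (ruelleOp w m hA hb hN)^[n] φ y| ≤ K * ‖x - y‖ ^ α)
    {h : ℝ} (hh : 0 < h) :
    EventuallyNearConst (fun n => (ruelleOp w m hA hb hN)^[n] φ) B h := by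
  have hB0 : 0 ≤ B := (abs_nonneg _).trans (hB 0)
  let S : Set ℝ :=
    {s | 0 ≤ s ∧ EventuallyNearConst (fun n => (ruelleOp w m hA hb hN)^[n] φ) B s}
  have hne : S.Nonempty := ⟨B, hB0, fun R => ⟨0, fun n _ => ⟨0, by simpa using hB0, fun x _ => by
    simpa using abs_iterate_ruelleOp_le w m hA hb hN hB n x⟩⟩⟩
  have hbdd : BddBelow S := ⟨0, fun s hs => hs.1⟩
  have hlt : sInf S < h := by
    by_contra! hge
    obtain ⟨b, hb0, hb1, hstep⟩ :=
      EventuallyNearConst.improve hm hA hb hN hd hα hK0 hB hK (half_pos hh)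
    obtain ⟨s, hs, hs'⟩ := exists_lt_of_csInf_lt hne
      (lt_add_of_pos_right (sInf S) (show 0 < b * h / 8 by positivity))
    have hmem : (1 - b) * s + b * (h / 2) + b * h / 8 ∈ S :=
      ⟨by have := mul_nonneg (sub_nonneg.2 hb1) hs.1; positivity,
        hstep s hs.1 _ (by positivity) hs.2⟩
    have := csInf_le hbdd hmem
    nlinarith [mul_le_mul_of_nonneg_left hs'.le (sub_nonneg.2 hb1), mul_pos hb0 hh,
      mul_le_mul_of_nonneg_left hge hb0.le, mul_pos hb0 (mul_pos hb0 hh)]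
  obtain ⟨s, hs, hsh⟩ := exists_lt_of_csInf_lt hne hlt
  intro R
  obtain ⟨N, hNR⟩ := hs.2 R
  refine ⟨N, fun n hn => ?_⟩
  obtain ⟨c, hcB, hc⟩ := hNR n hn
  exact ⟨c, hcB, fun x hx => (hc x hx).trans hsh.le⟩

/-- The dual iterates of two probability measures merge when tested against bounded Hölder
functions. -/
theorem tendsto_integral_iterate_ruelleDual_sub {α : ℝ≥0} (hα : 0 < α)
    (hd : Summable fun n : ℕ => (w.d (n + 1)) ^ (-(α : ℝ)))
    (hm : HasAdaptedTails p w m) (hA : IsBoundedHolder α A) (hN : IsNormalized w m A)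
    (φ : BoundedContinuousFunction (SeqSpace p) ℝ) {G : ℝ} (hG0 : 0 ≤ G)
    (hG : ∀ x y, |φ x - φ y| ≤ G * ‖x - y‖ ^ (α : ℝ)) (ν ν' : Measure (SeqSpace p))
    [IsProbabilityMeasure ν] [IsProbabilityMeasure ν'] :
    Tendsto (fun n => ∫ x, φ x ∂((ruelleDual w m A)^[n] ν) - ∫ x, φ x ∂((ruelleDual w m A)^[n] ν'))
      atTop (𝓝 0) := by
  have hAc := hA.continuous hα
  have hb := hA.1
  have hα' : (0 : ℝ) < α := by exact_mod_cast hα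
  obtain ⟨H, hH0, hH⟩ := hA.exists_abs_exp_sub_exp_le
  have hB : ∀ x, |φ x| ≤ ‖φ‖ := φ.norm_coe_le_norm
  obtain ⟨K, hK0, hK⟩ :=
    exists_forall_abs_iterate_ruelleOp_sub_le w m hAc hb hN hα' hH0 hG0 hd hB hH hG
  set u := fun n => (ruelleOp w m hAc hb hN)^[n] φ with hu
  have huB : ∀ n x, |u n x| ≤ ‖φ‖ := abs_iterate_ruelleOp_le w m hAc hb hN hB
  have hpt : ∀ x, Tendsto (fun n => u n x - u n 0) atTop (𝓝 0) := by
    intro x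
    rw [Metric.tendsto_atTop]
    intro ε hε
    obtain ⟨N, hNx⟩ := eventuallyNearConst_iterate_ruelleOp hm hAc hb hN
      (ShiftWeights.tendsto_inv_d hα' hd) hα' hK0 hB hK (h := ε / 3) (by positivity) ‖x‖
    refine ⟨N, fun n hn => ?_⟩
    obtain ⟨c, -, hc⟩ := hNx n hn
    have h1 := abs_le.1 (hc x le_rfl)
    have h2 := abs_le.1 (hc 0 (by simp))
    rw [dist_zero_right, Real.norm_eq_abs, abs_lt]
    constructor <;> linarith [h1.1, h1.2, h2.1, h2.2]
  have hint : ∀ (τ : Measure (SeqSpace p)) [IsProbabilityMeasure τ],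
      Tendsto (fun n => ∫ x, u n x ∂τ - u n 0) atTop (𝓝 0) := by
    intro τ _
    have h1 := tendsto_integral_of_dominated_convergence (μ := τ)
      (F := fun n x => u n x - u n 0) (f := fun _ => 0) (fun _ => 2 * ‖φ‖)
      (fun n => ((u n).continuous.sub continuous_const).aestronglyMeasurable)
      (integrable_const _)
      (fun n => ae_of_all _ fun x => (abs_sub _ _).trans (by linarith [huB n x, huB n 0]))
      (ae_of_all _ hpt)
    rw [integral_zero] at h1
    refine h1.congr fun n => ?_
    rw [integral_sub ((u n).integrable τ) (integrable_const _)]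
    simp
  have h := (hint ν).sub (hint ν')
  rw [sub_zero] at h
  refine h.congr fun n => ?_
  rw [integral_iterate_ruelleDual w m hAc hb hN, integral_iterate_ruelleDual w m hAc hb hN]
  ring

/-! ### The invariant measure -/

/-- A bounded Lipschitz function is `α`-Hölder for `α ≤ 1`: the Lipschitz bound serves at distances
below `1`, boundedness at the others. -/
theorem abs_sub_le_mul_rpow_of_lipschitz {X : Type*} [SeminormedAddCommGroup X] {f : X → ℝ}
    {C α : ℝ} {L : ℝ≥0} (hC : ∀ x y, dist (f x) (f y) ≤ C) (hL : LipschitzWith L f)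
    (hα0 : 0 < α) (hα1 : α ≤ 1) (x y : X) : |f x - f y| ≤ max C L * ‖x - y‖ ^ α := by
  have hC0 : 0 ≤ C := dist_nonneg.trans (hC x x)
  rcases le_total ‖x - y‖ 1 with h | h
  · have h1 := hL.dist_le_mul x y
    rw [Real.dist_eq, dist_eq_norm] at h1
    refine h1.trans (mul_le_mul (le_max_right _ _) ?_ (norm_nonneg _) (le_max_of_le_left hC0))
    rcases (norm_nonneg (x - y)).eq_or_lt with h0 | h0
    · rw [← h0, Real.zero_rpow hα0.ne']
    · simpa using Real.rpow_le_rpow_of_exponent_ge h0 h hα1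
  · have h1 := hC x y
    rw [Real.dist_eq] at h1
    exact h1.trans (le_trans (le_max_left _ _)
      (le_mul_of_one_le_right (le_max_of_le_left hC0) (Real.one_le_rpow h hα0.le)))

theorem coe_iterate_ruelleDualProb (hA : Continuous A) (hN : IsNormalized w m A)
    (ν : ProbabilityMeasure (SeqSpace p)) (n : ℕ) :
    ((ruelleDualProb w m A hA hN)^[n] ν : Measure (SeqSpace p)) =
      (ruelleDual w m A)^[n] (ν : Measure (SeqSpace p)) := by
  induction n with
  | zero => rfl
  | succ n ih =>
    rw [Function.iterate_succ_apply', Function.iterate_succ_apply', ← ih]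
    rfl

theorem tendsto_integral_iterate_ruelleDualProb_sub {α : ℝ≥0} (hα0 : 0 < α) (hα1 : α ≤ 1)
    (hd : Summable fun n : ℕ => (w.d (n + 1)) ^ (-(α : ℝ)))
    (hm : HasAdaptedTails p w m) (hA : IsBoundedHolder α A) (hN : IsNormalized w m A)
    {f : SeqSpace p → ℝ} (hC : ∃ C : ℝ, ∀ x y, dist (f x) (f y) ≤ C)
    (hL : ∃ L, LipschitzWith L f) (ν ν' : ProbabilityMeasure (SeqSpace p)) :
    Tendsto (fun n => ∫ x, f x ∂((ruelleDualProb w m A (hA.continuous hα0) hN)^[n] ν) -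
      ∫ x, f x ∂((ruelleDualProb w m A (hA.continuous hα0) hN)^[n] ν')) atTop (𝓝 0) := by
  obtain ⟨L, hL⟩ := hL
  obtain ⟨C, hC⟩ := hC
  simp only [coe_iterate_ruelleDualProb]
  exact tendsto_integral_iterate_ruelleDual_sub hα0 hd hm hA hN
    (BoundedContinuousFunction.mk ⟨f, hL.continuous⟩ ⟨C, hC⟩)
    (le_max_of_le_left (dist_nonneg.trans (hC 0 0)))
    (abs_sub_le_mul_rpow_of_lipschitz hC hL (by exact_mod_cast hα0) (by exact_mod_cast hα1)) ν ν'

theorem isCompact_closure_range_iterate_ruelleDualProb (hm : HasAdaptedTails p w m)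
    (hA : Continuous A) (hb : ∃ M : ℝ, ∀ x, |A x| ≤ M) (hN : IsNormalized w m A) :
    IsCompact (closure (Set.range fun n =>
      (ruelleDualProb w m A hA hN)^[n] (diracProba (0 : SeqSpace p)))) := by
  refine isCompact_closure_of_isTightMeasureSet
    (isTightMeasureSet_iff_exists_isCompact_measure_compl_le.2 fun ε hε => ?_)
  obtain ⟨δ, hδ0, hδ⟩ : ∃ δ : ℝ, 0 < δ ∧ ENNReal.ofReal δ ≤ ε := by
    obtain ⟨δ, hδ0, hδ⟩ := ENNReal.lt_iff_exists_nnreal_btwn.1 hε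
    exact ⟨δ, by exact_mod_cast hδ0, by simpa using hδ.le⟩
  obtain ⟨κ, -, hκ⟩ := hm.exists_order_interval hA hb hN hδ0
  refine ⟨_, SeqSpace.isCompact_setOf_abs_le κ, ?_⟩
  rintro _ ⟨_, ⟨n, rfl⟩, rfl⟩
  beta_reduce
  rw [coe_iterate_ruelleDualProb]
  change (ruelleDual w m A)^[n] (Measure.dirac 0) _ ≤ ε
  refine (le_of_eq ?_).trans ((hκ n 0).trans hδ)
  rw [iterate_preimagePoint_zero]
  congr 3
  ext v
  refine forall_congr' fun j => ?_
  change _ ↔ |v.1 j - 0| ≤ _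
  rw [sub_zero]

/-- A weak cluster point of the dual iterates of `δ_0` is invariant, because shifting the iterates
by one step does not change their asymptotic integrals. -/
theorem exists_ruelleDualProb_eq_self {α : ℝ≥0} (hα0 : 0 < α) (hα1 : α ≤ 1)
    (hd : Summable fun n : ℕ => (w.d (n + 1)) ^ (-(α : ℝ)))
    (hm : HasAdaptedTails p w m) (hA : IsBoundedHolder α A) (hN : IsNormalized w m A) :
    ∃ μ, ruelleDualProb w m A (hA.continuous hα0) hN μ = μ := by
  have hAc := hA.continuous hα0
  set P := ruelleDualProb w m A hAc hN with hP
  set δ : ProbabilityMeasure (SeqSpace p) := diracProba 0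
  obtain ⟨μ, -, hμ⟩ := (isCompact_closure_range_iterate_ruelleDualProb hm hAc hA.1
    hN).ultrafilter_le_nhds ((hyperfilter ℕ).map fun n => P^[n] δ) (by
      rw [le_principal_iff]
      exact mem_of_superset (Filter.range_mem_map) subset_closure)
  have hμ' : Tendsto (fun n => P^[n] δ) (hyperfilter ℕ) (𝓝 μ) := hμ
  have hle : (hyperfilter ℕ : Filter ℕ) ≤ atTop := Nat.hyperfilter_le_atTop
  rw [ProbabilityMeasure.tendsto_iff_forall_integral_tendsto] at hμ'
  refine ⟨μ, tendsto_nhds_unique (f := fun _ : ℕ => P μ) (l := atTop) tendsto_const_nhds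
    (tendsto_iff_forall_lipschitz_integral_tendsto.2 fun f hC hL => ?_)⟩
  let φ : BoundedContinuousFunction (SeqSpace p) ℝ := ⟨⟨f, hL.choose_spec.continuous⟩, hC⟩
  have h1 := hμ' φ
  have h2 := hμ' (ruelleOp w m hAc hA.1 hN φ)
  have h3 : ∀ ν : ProbabilityMeasure (SeqSpace p),
      ∫ x, ruelleOp w m hAc hA.1 hN φ x ∂ν = ∫ x, f x ∂(P ν) := fun ν =>
    (integral_ruelleDual w m hAc hA.1 ν φ).symm
  simp only [h3] at h2
  have h4 := (tendsto_integral_iterate_ruelleDualProb_sub hα0 hα1 hd hm hA hN hC hL (P δ)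
    δ).mono_left hle
  have h5 : Tendsto (fun n => ∫ x, f x ∂(P^[n] (P δ)) - ∫ x, f x ∂(P^[n] δ)) (hyperfilter ℕ)
      (𝓝 (∫ x, f x ∂(P μ) - ∫ x, f x ∂μ)) := by
    refine Tendsto.sub ?_ h1
    refine h2.congr fun n => ?_
    rw [← Function.iterate_succ_apply, Function.iterate_succ_apply']
  rw [sub_eq_zero.1 (tendsto_nhds_unique h5 h4)]
  exact tendsto_const_nhds

end Flattening

end

theorem mainTheorem2 (p : ℝ≥0∞) [Fact (1 ≤ p)] (w : ShiftWeights)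
    (α : ℝ≥0) (hα0 : 0 < α) (hα1 : α ≤ 1)
    (hd : Summable fun n : ℕ => (w.d (n + 1)) ^ (-(α : ℝ)))
    (m : Measure ℝ) [IsProbabilityMeasure m] (hsupp : m.support = Set.univ)
    (hm : HasAdaptedTails p w m)
    (A : SeqSpace p → ℝ) (hA : IsBoundedHolder α A) (hN : IsNormalized w m A) :
    ∃ μ : ProbabilityMeasure (SeqSpace p),
      (∀ ν : ProbabilityMeasure (SeqSpace p),
        Tendsto (fun n : ℕ => (ruelleDualProb w m A (hA.continuous hα0) hN)^[n] ν)
          atTop (𝓝 μ)) ∧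
      ruelleDualProb w m A (hA.continuous hα0) hN μ = μ ∧
      ∀ μ' : ProbabilityMeasure (SeqSpace p),
        ruelleDualProb w m A (hA.continuous hα0) hN μ' = μ' → μ' = μ := by
  obtain ⟨μ, hμ⟩ := exists_ruelleDualProb_eq_self hα0 hα1 hd hm hA hN
  have hlim : ∀ ν : ProbabilityMeasure (SeqSpace p),
      Tendsto (fun n : ℕ => (ruelleDualProb w m A (hA.continuous hα0) hN)^[n] ν)
        atTop (𝓝 μ) := fun ν => by
    refine tendsto_iff_forall_lipschitz_integral_tendsto.2 fun f hC hL => ?_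
    have h := tendsto_integral_iterate_ruelleDualProb_sub hα0 hα1 hd hm hA hN hC hL ν μ
    simp only [Function.iterate_fixed hμ] at h
    exact tendsto_sub_nhds_zero_iff.1 h
  refine ⟨μ, hlim, hμ, fun μ' hμ' => ?_⟩
  have h := hlim μ'
  simp only [Function.iterate_fixed hμ'] at h
  exact tendsto_nhds_unique tendsto_const_nhds h
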